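/- **Setting.** Fix $d \ge 1$ and constants $M, V$. Let $(X,Y) \in \mathbb{R}^d \times \mathbb{R}$ be such that $X$ is uniformly distributed on $[0,1]^d$, $\mathbb{E}(Y^2) < \infty$, and, almost surely, $|\mathbb{E}(Y \mid X)| \le M$ and $\mathrm{Var}(Y \mid X) \le V$. Let $D = \{(X_k, Y_k)\}_{k=1}^n$ be i.i.d. copies of $(X,Y)$, and let $X_i, X_j$ be two further (test) covariates, uniform on $[0,1]^d$; $X_i$, $X_j$ and the observations in $D$ are mutually independent. **Centered random forest.** For a parameter $k_n$, a random tree $\Theta$, independent of the data, partitions $[0,1]^d$ as follows. Starting from the single cell $[0,1]^d$, repeat $\lceil \log_2 k_n \rceil$ times: for every current cell choose, independently over all cells and rounds, one of the $d$ coordinates with probability $1/d$ each, and split the cell at the midpoint of that side. Let $A_n(x;\Theta)$ be the cell (leaf) of the final partition containing $x$, let $N_n(x;\Theta) = \sum_{k=1}^n \mathbf{1}\{X_k \in A_n(x;\Theta)\}$, and $$w_k(x;\Theta) = \frac{\mathbf{1}\{X_k \in A_n(x;\Theta)\}}{N_n(x;\Theta)}\,\mathbf{1}\{N_n(x;\Theta)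 > 0\}, \qquad \widehat\mu(x) = \sum_{k=1}^n \mathbb{E}\{w_k(x;\Theta) \mid D\}\, Y_k .$$ **Claim.** There is a constant $C$, depending only on $d$, $M$ and $V$, such that for every real sequence $k_n$ with $k_n \to \infty$ as $n \to \infty$ and all sufficiently large $n$ (how large depends on the sequence $k_n$ and $d$, $M$, $V$ only), $$\mathbb{E}\Big[\big|\mathrm{cov}\{\widehat\mu(X_i), \widehat\mu(X_j) \mid X_i, X_j\}\big|\Big] \le C\,\frac{(\log k_n)^{d-1}}{n}.$$ -/

import Mathlib

open MeasureTheory ProbabilityTheory Filter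
open scoped BigOperators

noncomputable section

/-- A tree of `m` successive rounds of splits in dimension `d`: every one of the `2 ^ m - 1`
internal nodes carries the coordinate (feature) along which its cell is split. -/
def SplitTree (d : ℕ) : ℕ → Type
  | 0 => Unit
  | m + 1 => Fin d × SplitTree d m × SplitTree d m

/-- There are finitely many feature labellings. Choosing the feature of every node
independently, with probability `1 / d` each, is the uniform law on `SplitTree d m`. -/
instance SplitTree.instFintype (d : ℕ) : (m : ℕ) → Fintype (SplitTree d m)
  | 0 => inferInstanceAs (Fintype Unit)
  | m + 1 =>
    letI := SplitTree.instFintype d m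
    inferInstanceAs (Fintype (Fin d × SplitTree d m × SplitTree d m))

/-- The leaf containing `x` of the partition of the cell `S` (a box with lower corner `lo` and
upper corner `hi`) that the tree produces: each node splits its cell at the midpoint of the
chosen side, the midpoint itself belonging to the upper half. -/
def SplitTree.leafIn {d : ℕ} : (m : ℕ) → SplitTree d m → Set (Fin d → ℝ) →
    (Fin d → ℝ) → (Fin d → ℝ) → (Fin d → ℝ) → Set (Fin d → ℝ)
  | 0, _, S, _, _, _ => S
  | m + 1, (a, l, r), S, lo, hi, x =>
    if x a < (lo a + hi a) / 2 then
      SplitTree.leafIn m l (S ∩ {y | y a < (lo a + hi a) / 2}) lo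
        (Function.update hi a ((lo a + hi a) / 2)) x
    else
      SplitTree.leafIn m r (S ∩ {y | (lo a + hi a) / 2 ≤ y a})
        (Function.update lo a ((lo a + hi a) / 2)) hi x

/-- `A(x; θ)`: the leaf of `x` in the partition of the unit cube `[0,1]^d` given by `θ`. -/
def SplitTree.leaf {d m : ℕ} (θ : SplitTree d m) (x : Fin d → ℝ) : Set (Fin d → ℝ) :=
  SplitTree.leafIn m θ (Set.Icc 0 1) 0 1 x

/-- `N(x; θ)`: the number of the training covariates `X` that lie in the leaf of `x`. -/
def leafCount {d m n : ℕ} (X : Fin n → Fin d → ℝ) (θ : SplitTree d m) (x : Fin d → ℝ) : ℝ :=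
  ∑ k, (θ.leaf x).indicator 1 (X k)

/-- `w_k(x; θ) = 1{X_k ∈ A(x; θ)} / N(x; θ) * 1{N(x; θ) > 0}`. -/
def treeWeight {d m n : ℕ} (X : Fin n → Fin d → ℝ) (θ : SplitTree d m) (x : Fin d → ℝ)
    (k : Fin n) : ℝ :=
  if 0 < leafCount X θ x then (θ.leaf x).indicator 1 (X k) / leafCount X θ x else 0

/-- The conditional expectation of `w_k(x; Θ)` given the training data, the random tree `Θ`
(all features chosen independently and uniformly) being independent of the data: the average
over all feature labellings. -/
def forestWeight {d n : ℕ} (m : ℕ) (X : Fin n → Fin d → ℝ) (x : Fin d → ℝ) (k : Fin n) : ℝ :=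
  (∑ θ : SplitTree d m, treeWeight X θ x k) / Fintype.card (SplitTree d m)

/-- The number of rounds of splits for the tuning parameter `κ`: `⌈log₂ κ⌉`. -/
def splitDepth (κ : ℝ) : ℕ := ⌈Real.logb 2 κ⌉₊

/-- The centered random forest estimator `μ̂(x)` with tuning parameter `κ`, trained on the
sample `(X_k, Y_k)`, `k < n`. -/
def centeredForest {d n : ℕ} (κ : ℝ) (X : Fin n → Fin d → ℝ) (Y : Fin n → ℝ)
    (x : Fin d → ℝ) : ℝ :=
  ∑ k, forestWeight (splitDepth κ) X x k * Y k

/-- The uniform distribution on the unit cube `[0,1]^d`. -/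
def uniformCube (d : ℕ) : Measure (Fin d → ℝ) := volume.restrict (Set.Icc 0 1)

/-- The σ-algebra on `ℝ^d × ℝ` generated by the covariate. -/
abbrev covariateSigma (d : ℕ) : MeasurableSpace ((Fin d → ℝ) × ℝ) :=
  MeasurableSpace.comap Prod.fst inferInstance

/-- Conditions on the law `Q` of one observation `(X, Y)`: `X` is uniform on the unit cube, `Y`
is square integrable, `|E(Y | X)| ≤ M` and `Var(Y | X) ≤ V` almost surely. -/
structure IsForestLaw {d : ℕ} (Q : Measure ((Fin d → ℝ) × ℝ)) (M V : ℝ) : Prop where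
  uniform : Q.map Prod.fst = uniformCube d
  memLp : MemLp Prod.snd 2 Q
  mean_le : ∀ᵐ z ∂Q, |(Q[Prod.snd | covariateSigma d]) z| ≤ M
  var_le : ∀ᵐ z ∂Q, (Var[Prod.snd; Q | covariateSigma d]) z ≤ V

/-- The training sample `(X_k, Y_k)`, `k < n`, is i.i.d. with law `Q`; the two test points `ξ`
and `ξ'` have the covariate law of `Q`; all of these are independent. -/
structure IsForestSample {d n : ℕ} {Ω : Type*} [MeasurableSpace Ω] (P : Measure Ω)
    (Q : Measure ((Fin d → ℝ) × ℝ)) (X : Fin n → Ω → Fin d → ℝ) (Y : Fin n → Ω → ℝ)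
    (ξ ξ' : Ω → Fin d → ℝ) : Prop where
  measurable_X : ∀ k, Measurable (X k)
  measurable_Y : ∀ k, Measurable (Y k)
  measurable_test : Measurable ξ
  measurable_test' : Measurable ξ'
  law_train : ∀ k, P.map (fun ω => (X k ω, Y k ω)) = Q
  law_test : P.map ξ = Q.map Prod.fst
  law_test' : P.map ξ' = Q.map Prod.fst
  indep_train : iIndepFun (fun k ω => (X k ω, Y k ω)) P
  indep_test : IndepFun ξ ξ' P
  indep_test_train : IndepFun (fun ω => (ξ ω, ξ' ω)) (fun ω k => (X k ω, Y k ω)) P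

/-- The conditional covariance of `f` and `g` given the sub-σ-algebra `m`. -/
def condCovariance {Ω : Type*} {m₀ : MeasurableSpace Ω} (m : MeasurableSpace Ω) (f g : Ω → ℝ)
    (P : Measure[m₀] Ω) : Ω → ℝ :=
  P[(f - P[f | m]) * (g - P[g | m]) | m]

end

/-! The forest prediction is the average over all labelled trees of the mean response in the leaf of
the test point, so by bilinearity its covariance at two points is at most the average, over pairs of
trees, of the absolute covariances of two cell means. Every leaf has measure exactly `p = 2⁻¹ ^ m`,
whatever the tree, where `m` is the number of rounds.

For two cells `A`, `A'` of probability `p`, let `q` be the probability of `A ∩ A'`. The covariance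
of their means is written as a sum over observations of half the expected product of two increments,
each caused by replacing that observation by an independent copy (`abs_integral_mul_sub_le`). An
increment vanishes unless the old or the new observation lies in the cell, and is then of the size
of a response deviation over `N + 1`. Hence both increments are nonzero with probability of order
`q` (the same point hits both cells) plus `p ^ 2` (different points do). Since the mean of `(N +
1)⁻²` is at most `2 / (n p) ^ 2` and `E(Y² | X) ≤ M ^ 2 + |V|`, summing over `n` observations gives
a bound of order `(q + p ^ 2) / (n p ^ 2)` (`abs_covariance_cellMean_le`).

Averaged over two independent uniform test points, the overlap `q` has mean exactly `p ^ 2`, for any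
pair of trees. So the expected absolute covariance is at most `16 (M ^ 2 + |V|) / n` for every `n ≥
1` and every tuning parameter. The logarithmic factor is only slack, as it is eventually at least
one. -/

namespace SplitTree

/-! ### Geometry of the leaves: partition property, measure, mean overlap. -/

variable {d : ℕ}

theorem leafIn_subset : ∀ (m : ℕ) (θ : SplitTree d m) (S : Set (Fin d → ℝ)) (lo hi x : Fin d → ℝ),
    leafIn m θ S lo hi x ⊆ S
  | 0, _, _, _, _, _ => subset_rfl
  | m + 1, (a, l, r), S, lo, hi, x => by
    rw [leafIn]
    split_ifs
    · exact (leafIn_subset m l _ _ _ _).trans Set.inter_subset_left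
    · exact (leafIn_subset m r _ _ _ _).trans Set.inter_subset_left

theorem mem_leafIn_self : ∀ (m : ℕ) (θ : SplitTree d m) (S : Set (Fin d → ℝ))
    (lo hi x : Fin d → ℝ), x ∈ S → x ∈ leafIn m θ S lo hi x
  | 0, _, _, _, _, _, h => h
  | m + 1, (a, l, r), S, lo, hi, x, h => by
    rw [leafIn]
    split_ifs with hx
    · exact mem_leafIn_self m l _ _ _ _ ⟨h, hx⟩
    · exact mem_leafIn_self m r _ _ _ _ ⟨h, not_lt.1 hx⟩

/-- A leaf stays inside the half cell chosen at each node, so `y` takes the same branch as `x` all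
the way down. This makes leaf membership symmetric on the cube. -/
theorem leafIn_eq_of_mem : ∀ (m : ℕ) (θ : SplitTree d m) (S : Set (Fin d → ℝ))
    (lo hi x y : Fin d → ℝ), y ∈ leafIn m θ S lo hi x →
    leafIn m θ S lo hi y = leafIn m θ S lo hi x
  | 0, _, _, _, _, _, _, _ => rfl
  | m + 1, (a, l, r), S, lo, hi, x, y, h => by
    rw [leafIn] at h
    rw [leafIn, leafIn]
    split_ifs at h with hx
    · have hy : y a < (lo a + hi a) / 2 := (leafIn_subset m l _ _ _ _ h).2
      rw [if_pos hx, if_pos hy]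
      exact leafIn_eq_of_mem m l _ _ _ _ _ h
    · have hy : ¬ y a < (lo a + hi a) / 2 := not_lt.2 (leafIn_subset m r _ _ _ _ h).2
      rw [if_neg hx, if_neg hy]
      exact leafIn_eq_of_mem m r _ _ _ _ _ h

theorem measurableSet_mem_leafIn : ∀ (m : ℕ) (θ : SplitTree d m) (S : Set (Fin d → ℝ))
    (lo hi : Fin d → ℝ), MeasurableSet S →
    MeasurableSet {z : (Fin d → ℝ) × (Fin d → ℝ) | z.2 ∈ leafIn m θ S lo hi z.1}
  | 0, _, _, _, _, hS => measurable_snd hS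
  | m + 1, (a, l, r), S, lo, hi, hS => by
    have hc : MeasurableSet {z : (Fin d → ℝ) × (Fin d → ℝ) | z.1 a < (lo a + hi a) / 2} :=
      measurableSet_lt (by fun_prop) measurable_const
    have h1 := measurableSet_mem_leafIn m l (S ∩ {y | y a < (lo a + hi a) / 2}) lo
      (Function.update hi a ((lo a + hi a) / 2))
      (hS.inter (measurableSet_lt (by fun_prop) measurable_const))
    have h2 := measurableSet_mem_leafIn m r (S ∩ {y | (lo a + hi a) / 2 ≤ y a})
      (Function.update lo a ((lo a + hi a) / 2)) hi
      (hS.inter (measurableSet_le measurable_const (by fun_prop)))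
    convert (hc.inter h1).union (hc.compl.inter h2) using 1
    ext z
    simp only [leafIn, Set.mem_ofPred_eq, Set.mem_union, Set.mem_inter_iff, Set.mem_compl_iff]
    split_ifs with hz <;> simp [hz]

/-- Each split halves one side of the box, so the chosen coordinates do not matter. The cell `S`
agrees with the closed box only almost everywhere, because lower halves are open at the midpoint. -/
theorem volume_leafIn : ∀ (m : ℕ) (θ : SplitTree d m) (S : Set (Fin d → ℝ))
    (lo hi x : Fin d → ℝ), lo ≤ hi → S =ᵐ[volume] Set.Icc lo hi →
    volume (leafIn m θ S lo hi x) = volume (Set.Icc lo hi) / 2 ^ m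
  | 0, _, S, lo, hi, x, _, hS => by simpa [leafIn] using measure_congr hS
  | m + 1, (a, l, r), S, lo, hi, x, hle, hS => by
    have hmid : lo a ≤ (lo a + hi a) / 2 ∧ (lo a + hi a) / 2 ≤ hi a := by
      constructor <;> linarith [hle a]
    have hnull : ∀ᵐ y : Fin d → ℝ, y a ≠ (lo a + hi a) / 2 := by
      rw [volume_pi]
      exact Measure.ae_eval_ne _ a _
    have hvol : ∀ lo' hi' : Fin d → ℝ, (∀ i, i ≠ a → hi' i - lo' i = hi i - lo i) →
        hi' a - lo' a = (hi a - lo a) / 2 →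
        volume (Set.Icc lo' hi') = volume (Set.Icc lo hi) / 2 := by
      intro lo' hi' h1 h2
      rw [Real.volume_Icc_pi, Real.volume_Icc_pi, ← Finset.mul_prod_erase _ _ (Finset.mem_univ a),
        ← Finset.mul_prod_erase _ _ (Finset.mem_univ a), h2,
        Finset.prod_congr rfl fun i hi' => by rw [h1 i (Finset.ne_of_mem_erase hi')],
        ENNReal.ofReal_div_of_pos two_pos, ENNReal.ofReal_ofNat, ENNReal.mul_div_right_comm]
    have hpow : ∀ v : ENNReal, v / 2 / 2 ^ m = v / 2 ^ (m + 1) := by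
      intro v
      rw [pow_succ', div_eq_mul_inv, div_eq_mul_inv, div_eq_mul_inv, ENNReal.mul_inv (by simp)
        (by simp), mul_assoc]
    rw [leafIn]
    split_ifs with hx
    · rw [volume_leafIn m l _ _ _ _ ?_ ?_, hvol, hpow]
      · intro i hi; simp [hi]
      · simp; ring
      · intro i
        by_cases h : i = a
        · subst h; simpa using hmid.1
        · simpa [h] using hle i
      · filter_upwards [hS, hnull] with y hy hya
        simp only [eq_iff_iff] at hy ⊢
        change (y ∈ S ↔ y ∈ Set.Icc lo hi) at hy
        change (y ∈ S ∧ y a < _ ↔ y ∈ Set.Icc _ _)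
        rw [hy, Set.mem_Icc, Set.mem_Icc, and_assoc]
        refine and_congr_right fun _ => ?_
        simp only [Pi.le_def]
        constructor
        · rintro ⟨h1, h2⟩ i
          by_cases h : i = a
          · subst h; simpa using h2.le
          · simpa [h] using h1 i
        · intro h1
          have h2 : y a ≤ (lo a + hi a) / 2 := by simpa using h1 a
          refine ⟨fun i => ?_, lt_of_le_of_ne h2 hya⟩
          by_cases h : i = a
          · subst h; exact h2.trans hmid.2
          · simpa [h] using h1 i
    · rw [volume_leafIn m r _ _ _ _ ?_ ?_, hvol, hpow]
      · intro i hi; simp [hi]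
      · simp; ring
      · intro i
        by_cases h : i = a
        · subst h; simpa using hmid.2
        · simpa [h] using hle i
      · filter_upwards [hS] with y hy
        simp only [eq_iff_iff] at hy ⊢
        change (y ∈ S ↔ y ∈ Set.Icc lo hi) at hy
        change (y ∈ S ∧ _ ≤ y a ↔ y ∈ Set.Icc _ _)
        rw [hy, Set.mem_Icc, Set.mem_Icc, and_right_comm]
        refine and_congr_left fun _ => ?_
        simp only [Pi.le_def]
        constructor
        · rintro ⟨h1, h2⟩ i
          by_cases h : i = a
          · subst h; simpa using h2
          · simpa [h] using h1 i
        · intro h1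
          have h2 : (lo a + hi a) / 2 ≤ y a := by simpa using h1 a
          refine ⟨fun i => ?_, h2⟩
          by_cases h : i = a
          · subst h; exact hmid.1.trans h2
          · simpa [h] using h1 i

theorem measurableSet_mem_leaf {m : ℕ} (θ : SplitTree d m) :
    MeasurableSet {z : (Fin d → ℝ) × (Fin d → ℝ) | z.2 ∈ θ.leaf z.1} :=
  measurableSet_mem_leafIn m θ _ _ _ measurableSet_Icc

theorem measurableSet_leaf {m : ℕ} (θ : SplitTree d m) (x : Fin d → ℝ) :
    MeasurableSet (θ.leaf x) :=
  measurable_prodMk_left (x := x) θ.measurableSet_mem_leaf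

theorem leaf_subset_Icc {m : ℕ} (θ : SplitTree d m) (x : Fin d → ℝ) :
    θ.leaf x ⊆ Set.Icc 0 1 :=
  leafIn_subset m θ _ _ _ x

theorem uniformCube_leaf {m : ℕ} (θ : SplitTree d m) (x : Fin d → ℝ) :
    uniformCube d (θ.leaf x) = 2⁻¹ ^ m := by
  rw [uniformCube, Measure.restrict_apply (θ.measurableSet_leaf x),
    Set.inter_eq_left.2 (θ.leaf_subset_Icc x), leaf,
    volume_leafIn m θ _ 0 1 x zero_le_one (ae_eq_refl _), Real.volume_Icc_pi]
  simp [ENNReal.inv_pow]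

theorem mem_leaf_comm {m : ℕ} (θ : SplitTree d m) {x y : Fin d → ℝ} (hx : x ∈ Set.Icc 0 1)
    (hy : y ∈ Set.Icc 0 1) : y ∈ θ.leaf x ↔ x ∈ θ.leaf y := by
  constructor <;> intro h
  · rw [leaf, leafIn_eq_of_mem m θ _ _ _ _ _ h]
    exact mem_leafIn_self m θ _ _ _ _ hx
  · rw [leaf, leafIn_eq_of_mem m θ _ _ _ _ _ h]
    exact mem_leafIn_self m θ _ _ _ _ hy

instance : IsProbabilityMeasure (uniformCube d) :=
  ⟨by rw [uniformCube, Measure.restrict_apply_univ, Real.volume_Icc_pi]; simp⟩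

/-- Averaged over the position of one of the two test points, two leaves of measures `p` and `p'`
overlap in measure `p * p'`. -/
theorem lintegral_uniformCube_leaf_inter {m : ℕ} (θ : SplitTree d m) {A : Set (Fin d → ℝ)}
    (hA : MeasurableSet A) :
    ∫⁻ x, uniformCube d (A ∩ θ.leaf x) ∂uniformCube d = uniformCube d A * 2⁻¹ ^ m := by
  have hmem : ∀ᵐ x ∂uniformCube d, x ∈ Set.Icc (0 : Fin d → ℝ) 1 :=
    ae_restrict_mem measurableSet_Icc
  have h2 := θ.measurableSet_mem_leaf
  calc ∫⁻ x, uniformCube d (A ∩ θ.leaf x) ∂uniformCube d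
      = ∫⁻ x, ∫⁻ y, {z : (Fin d → ℝ) × (Fin d → ℝ) | z.2 ∈ A ∧ z.2 ∈ θ.leaf z.1}.indicator 1
          (x, y) ∂uniformCube d ∂uniformCube d := by
        refine lintegral_congr fun x => ?_
        rw [← lintegral_indicator_one (hA.inter (θ.measurableSet_leaf x))]
        rfl
    -- After Fubini, symmetry turns the set of `x` whose leaf contains `y` into the leaf of `y`, of
    -- measure `2⁻¹ ^ m`.
    _ = ∫⁻ y, ∫⁻ x, {z : (Fin d → ℝ) × (Fin d → ℝ) | z.2 ∈ A ∧ z.2 ∈ θ.leaf z.1}.indicator 1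
          (x, y) ∂uniformCube d ∂uniformCube d := by
        refine lintegral_lintegral_swap (Measurable.aemeasurable ?_)
        exact (measurable_one.indicator ((measurable_snd hA).inter h2))
    _ = ∫⁻ y, A.indicator (fun _ => 2⁻¹ ^ m) y ∂uniformCube d := by
        refine lintegral_congr_ae ?_
        filter_upwards [hmem] with y hy
        by_cases hyA : y ∈ A
        · rw [Set.indicator_of_mem hyA, ← θ.uniformCube_leaf y,
            ← lintegral_indicator_one (θ.measurableSet_leaf y)]
          refine lintegral_congr_ae ?_
          filter_upwards [hmem] with x hx
          have hiff : (x, y) ∈ {z : (Fin d → ℝ) × (Fin d → ℝ) | z.2 ∈ A ∧ z.2 ∈ θ.leaf z.1} ↔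
              x ∈ θ.leaf y := (and_iff_right hyA).trans (θ.mem_leaf_comm hx hy)
          by_cases h : x ∈ θ.leaf y
          · rw [Set.indicator_of_mem (hiff.2 h), Set.indicator_of_mem h]; rfl
          · rw [Set.indicator_of_notMem (mt hiff.1 h), Set.indicator_of_notMem h]
        · simp [hyA]
    _ = _ := by rw [lintegral_indicator_const hA, mul_comm]

end SplitTree

/-! ### A covariance bound by exchanging observations one at a time. -/

section Exchange

variable {E : Type*} [MeasurableSpace E] {n : ℕ}

/-- The sample whose first `i` entries are the second components of `w`, the others the first. -/
def hybrid (i : ℕ) (w : Fin n → E × E) : Fin n → E :=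
  fun j => if (j : ℕ) < i then (w j).2 else (w j).1

/-- The first components of `w`, with entry `k` replaced by the second component. -/
def exchangeAt (k : Fin n) (w : Fin n → E × E) : Fin n → E :=
  fun j => if j = k then (w j).2 else (w j).1

variable (Q : Measure E) [IsProbabilityMeasure Q]

/-- Which component is kept depends on the index alone, never on the data, so the selected entries
are still independent with law `Q`. -/
theorem measurePreserving_choose (p : Fin n → Prop) [DecidablePred p] :
    MeasurePreserving (fun (w : Fin n → E × E) j => if p j then (w j).2 else (w j).1)
      (Measure.pi fun _ => Q.prod Q) (Measure.pi fun _ => Q) := by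
  refine measurePreserving_pi (f := fun j (z : E × E) => if p j then z.2 else z.1) _ _ fun j => ?_
  by_cases h : p j
  · simpa [h] using measurePreserving_snd
  · simpa [h] using measurePreserving_fst

theorem measurePreserving_hybrid (i : ℕ) :
    MeasurePreserving (hybrid (E := E) (n := n) i) (Measure.pi fun _ => Q.prod Q)
      (Measure.pi fun _ => Q) :=
  measurePreserving_choose Q fun j => (j : ℕ) < i

theorem measurePreserving_exchangeAt (k : Fin n) :
    MeasurePreserving (exchangeAt (E := E) k) (Measure.pi fun _ => Q.prod Q)
      (Measure.pi fun _ => Q) :=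
  measurePreserving_choose Q fun j => j = k

theorem measurePreserving_swapAt (k : Fin n) :
    MeasurePreserving (fun (w : Fin n → E × E) j => if j = k then (w j).swap else w j)
      (Measure.pi fun _ => Q.prod Q) (Measure.pi fun _ => Q.prod Q) := by
  refine measurePreserving_pi (f := fun j (z : E × E) => if j = k then z.swap else z) _ _
    fun j => ?_
  by_cases h : j = k
  · simpa [h] using Measure.measurePreserving_swap
  · simp only [h, if_false]
    exact MeasurePreserving.id _

variable {Q}

/-- The two samples share no component, hence are independent. This is the end of the telescoping
sum, where the product of the means appears. -/
theorem integral_mul_hybrid_full {F G : (Fin n → E) → ℝ} :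
    ∫ w, F (hybrid 0 w) * G (hybrid n w) ∂(Measure.pi fun _ => Q.prod Q)
      = (∫ z, F z ∂(Measure.pi fun _ => Q)) * ∫ z, G z ∂(Measure.pi fun _ => Q) := by
  have h := measurePreserving_arrowProdEquivProdArrow E E (Fin n) (fun _ => Q) (fun _ => Q)
  have h0 : ∀ w : Fin n → E × E, F (hybrid 0 w) * G (hybrid n w)
      = (fun z : (Fin n → E) × (Fin n → E) => F z.1 * G z.2)
        (MeasurableEquiv.arrowProdEquivProdArrow E E (Fin n) w) := by
    intro w
    have hn : hybrid n w = fun c => (w c).2 := by ext1 c; simp [hybrid]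
    have hz : hybrid 0 w = fun c => (w c).1 := by ext1 c; simp [hybrid]
    rw [hn, hz]
    rfl
  simp_rw [h0]
  rw [h.integral_comp' (fun z : (Fin n → E) × (Fin n → E) => F z.1 * G z.2), integral_prod_mul]

/-- The covariance of two functions of an independent sample is bounded by the sum, over the
entries, of the mean products of the increments that exchanging one entry produces. -/
theorem abs_integral_mul_sub_le {F G : (Fin n → E) → ℝ}
    (hF : MemLp F 2 (Measure.pi fun _ => Q)) (hG : MemLp G 2 (Measure.pi fun _ => Q)) :
    |∫ z, F z * G z ∂(Measure.pi fun _ => Q)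
        - (∫ z, F z ∂(Measure.pi fun _ => Q)) * ∫ z, G z ∂(Measure.pi fun _ => Q)|
      ≤ ∑ k : Fin n, (∫ w, |F (hybrid 0 w) - F (exchangeAt k w)|
          * |G (hybrid k w) - G (hybrid (k + 1) w)| ∂(Measure.pi fun _ => Q.prod Q)) / 2 := by
  set ρ := Measure.pi fun _ : Fin n => Q.prod Q
  have hFh : ∀ i, MemLp (fun w => F (hybrid i w)) 2 ρ := fun i =>
    hF.comp_measurePreserving (measurePreserving_hybrid Q i)
  have hFe : ∀ k, MemLp (fun w => F (exchangeAt k w)) 2 ρ := fun k =>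
    hF.comp_measurePreserving (measurePreserving_exchangeAt Q k)
  have hGh : ∀ i, MemLp (fun w => G (hybrid i w)) 2 ρ := fun i =>
    hG.comp_measurePreserving (measurePreserving_hybrid Q i)
  have hint : ∀ i, Integrable (fun w => F (hybrid 0 w) * G (hybrid i w)) ρ := fun i =>
    (hFh 0).integrable_mul (hGh i)
  have h0 : ∫ z, F z * G z ∂(Measure.pi fun _ => Q)
      = ∫ w, F (hybrid 0 w) * G (hybrid 0 w) ∂ρ := by
    have hm := measurePreserving_hybrid (n := n) Q 0
    rw [← hm.map_eq, integral_map hm.measurable.aemeasurable]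
    rw [hm.map_eq]
    exact (hF.integrable_mul hG).aestronglyMeasurable
  have htel : ∫ w, F (hybrid 0 w) * G (hybrid 0 w) ∂ρ - ∫ w, F (hybrid 0 w) * G (hybrid n w) ∂ρ
      = ∑ k : Fin n, (∫ w, F (hybrid 0 w) * G (hybrid k w) ∂ρ
          - ∫ w, F (hybrid 0 w) * G (hybrid (k + 1) w) ∂ρ) := by
    rw [Fin.sum_univ_eq_sum_range (fun k => ∫ w, F (hybrid 0 w) * G (hybrid k w) ∂ρ
          - ∫ w, F (hybrid 0 w) * G (hybrid (k + 1) w) ∂ρ), Finset.sum_range_sub']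
  rw [← integral_mul_hybrid_full, h0, htel]
  refine (Finset.abs_sum_le_sum_abs _ _).trans (Finset.sum_le_sum fun k _ => ?_)
  rw [← integral_sub (hint _) (hint _)]
  have hsw := measurePreserving_swapAt Q k
  have e1 : ∀ w : Fin n → E × E,
      hybrid 0 (fun j => if j = k then (w j).swap else w j) = exchangeAt k w := by
    intro w; ext1 j; by_cases h : j = k <;> simp [hybrid, exchangeAt, h]
  have e2 : ∀ w : Fin n → E × E,
      hybrid k (fun j => if j = k then (w j).swap else w j) = hybrid (k + 1) w := by
    intro w; ext1 j; by_cases h : j = k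
    · simp [hybrid, h]
    · have : ((j : ℕ) < k + 1) ↔ (j : ℕ) < k := by
        have := Fin.val_ne_of_ne h; omega
      simp [hybrid, h, this]
  have e3 : ∀ w : Fin n → E × E,
      hybrid (k + 1) (fun j => if j = k then (w j).swap else w j) = hybrid k w := by
    intro w; ext1 j; by_cases h : j = k
    · simp [hybrid, h]
    · have : ((j : ℕ) < k + 1) ↔ (j : ℕ) < k := by
        have := Fin.val_ne_of_ne h; omega
      simp [hybrid, h, this]
  -- Swapping the `k`-th pair preserves the law, interchanges `hybrid k` and `hybrid (k + 1)`, and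
  -- turns `hybrid 0` into `exchangeAt k`.
  have hswint : ∫ w, (F (hybrid 0 w) * G (hybrid k w) - F (hybrid 0 w) * G (hybrid (k + 1) w)) ∂ρ
      = ∫ w, (F (exchangeAt k w) * G (hybrid (k + 1) w)
          - F (exchangeAt k w) * G (hybrid k w)) ∂ρ := by
    have h := integral_map hsw.measurable.aemeasurable (f := fun w => F (hybrid 0 w) *
      G (hybrid k w) - F (hybrid 0 w) * G (hybrid (k + 1) w)) (by
        rw [hsw.map_eq]; exact ((hint _).sub (hint _)).aestronglyMeasurable)
    rw [hsw.map_eq] at h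
    simpa only [e1, e2, e3] using h
  -- The telescoping term is the mean of its two equal forms, before and after the swap; their sum
  -- factors into a product of increments.
  have hhalf : ∫ w, (F (hybrid 0 w) * G (hybrid k w)
        - F (hybrid 0 w) * G (hybrid (k + 1) w)) ∂ρ
      = (∫ w, (F (hybrid 0 w) - F (exchangeAt k w))
          * (G (hybrid k w) - G (hybrid (k + 1) w)) ∂ρ) / 2 := by
    have hadd : ∫ w, (F (hybrid 0 w) - F (exchangeAt k w))
          * (G (hybrid k w) - G (hybrid (k + 1) w)) ∂ρ
        = ∫ w, (F (hybrid 0 w) * G (hybrid k w) - F (hybrid 0 w) * G (hybrid (k + 1) w)) ∂ρ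
          + ∫ w, (F (exchangeAt k w) * G (hybrid (k + 1) w)
          - F (exchangeAt k w) * G (hybrid k w)) ∂ρ := by
      refine Eq.trans (integral_congr_ae (.of_forall fun w => ?_)) (integral_add
        (f := fun w => F (hybrid 0 w) * G (hybrid k w) - F (hybrid 0 w) * G (hybrid (k + 1) w))
        (g := fun w => F (exchangeAt k w) * G (hybrid (k + 1) w)
          - F (exchangeAt k w) * G (hybrid k w)) ((hint _).sub (hint _))
        (((hFe k).integrable_mul (hGh (k + 1))).sub ((hFe k).integrable_mul (hGh k))))
      simp only
      ring
    rw [hadd, ← hswint]; ring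
  rw [hhalf, abs_div, abs_two]
  gcongr
  refine (abs_integral_le_integral_abs).trans_eq ?_
  simp_rw [abs_mul]

end Exchange

/-! ### Averages over a single cell and their moments. -/

noncomputable section CellMean

variable {α : Type*}

/-- The number of sample points whose covariate lies in `A`. -/
def cellCount (A : Set α) {n : ℕ} (z : Fin n → α × ℝ) : ℝ :=
  ∑ k, A.indicator 1 (z k).1

/-- The average response over the sample points whose covariate lies in `A`; it is `0` if there
are none. -/
def cellMean (A : Set α) {n : ℕ} (z : Fin n → α × ℝ) : ℝ :=
  (∑ k, A.indicator 1 (z k).1 * (z k).2) / cellCount A z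

section Deterministic

variable {A : Set α} {n : ℕ}

theorem indicator_one_nonneg (A : Set α) (x : α) : 0 ≤ A.indicator (1 : α → ℝ) x :=
  Set.indicator_nonneg (fun _ _ => zero_le_one) x

theorem cellCount_nonneg (z : Fin n → α × ℝ) : 0 ≤ cellCount A z :=
  Finset.sum_nonneg fun _ _ => indicator_one_nonneg A _

theorem indicator_le_cellCount (z : Fin n → α × ℝ) (k : Fin n) :
    A.indicator (1 : α → ℝ) (z k).1 ≤ cellCount A z :=
  Finset.single_le_sum (f := fun k => A.indicator (1 : α → ℝ) (z k).1)
    (fun _ _ => indicator_one_nonneg A _) (Finset.mem_univ k)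

theorem cellMean_mul_cellCount (z : Fin n → α × ℝ) :
    cellMean A z * cellCount A z = ∑ k, A.indicator 1 (z k).1 * (z k).2 := by
  by_cases h : cellCount A z = 0
  · rw [h, mul_zero]
    refine (Finset.sum_eq_zero fun k _ => ?_).symm
    have := indicator_le_cellCount (A := A) z k
    rw [le_antisymm (this.trans h.le) (indicator_one_nonneg A _), zero_mul]
  · exact div_mul_cancel₀ _ h

theorem cellCount_succAbove (k : Fin (n + 1)) (z : Fin (n + 1) → α × ℝ) :
    cellCount A z = A.indicator 1 (z k).1 + cellCount A fun j => z (k.succAbove j) := by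
  rw [cellCount, Fin.sum_univ_succAbove _ k, cellCount]

/-- The running update of a mean. It also covers a cell left empty by the other observations, where
the old mean is `0` and the denominator `1`. -/
theorem cellMean_succAbove (k : Fin (n + 1)) (z : Fin (n + 1) → α × ℝ) :
    cellMean A z = cellMean A (fun j => z (k.succAbove j)) + A.indicator 1 (z k).1 *
      (((z k).2 - cellMean A fun j => z (k.succAbove j)) /
        ((cellCount A fun j => z (k.succAbove j)) + 1)) := by
  have hN := cellCount_nonneg (A := A) fun j => z (k.succAbove j)
  have hS := cellMean_mul_cellCount (A := A) fun j => z (k.succAbove j)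
  rw [cellMean, cellCount_succAbove k, Fin.sum_univ_succAbove _ k, ← hS]
  by_cases h : (z k).1 ∈ A
  · rw [Set.indicator_of_mem h, Pi.one_apply]
    have h1 : (cellCount A fun j => z (k.succAbove j)) + 1 ≠ 0 := by positivity
    rw [add_comm 1 (cellCount A _)]
    field_simp
    ring
  · rw [Set.indicator_of_notMem h, zero_mul, zero_mul, zero_add, zero_add, add_zero, hS, cellMean]

/-- Cauchy–Schwarz, using that an indicator equals its square. -/
theorem sq_cellMean_le (z : Fin n → α × ℝ) :
    cellMean A z ^ 2 ≤ (∑ k, A.indicator 1 (z k).1 * (z k).2 ^ 2) / cellCount A z := by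
  have hI : ∀ x, A.indicator (1 : α → ℝ) x ^ 2 = A.indicator 1 x := fun x => by
    by_cases h : x ∈ A <;> simp [h]
  have h := Finset.sum_mul_sq_le_sq_mul_sq Finset.univ
    (fun k => A.indicator (1 : α → ℝ) (z k).1) fun k => A.indicator (1 : α → ℝ) (z k).1 * (z k).2
  simp only [mul_pow, hI, ← mul_assoc, ← pow_two] at h
  rcases (cellCount_nonneg (A := A) z).eq_or_lt with h0 | h0
  · simp [cellMean, ← h0]
  · rw [cellMean, div_pow, div_le_div_iff₀ (by positivity) h0]
    have := mul_le_mul_of_nonneg_right h h0.le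
    rw [← cellCount] at this
    linarith

/-- A crude domination whose merit is that it does not depend on the cell; it supplies all the
integrability. -/
theorem abs_cellMean_le (z : Fin n → α × ℝ) : |cellMean A z| ≤ ∑ k, |(z k).2| := by
  rw [cellMean, Finset.sum_div]
  refine (Finset.abs_sum_le_sum_abs _ _).trans (Finset.sum_le_sum fun k _ => ?_)
  by_cases h : (z k).1 ∈ A
  · have h1 := indicator_le_cellCount (A := A) z k
    rw [Set.indicator_of_mem h] at h1 ⊢
    rw [Pi.one_apply] at h1 ⊢
    rw [one_mul, abs_div, abs_of_nonneg (zero_le_one.trans h1)]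
    exact div_le_self (abs_nonneg _) h1
  · simp [h]

/-- The change of `cellMean` when the `k`-th observation is replaced. -/
theorem cellMean_sub_of_eq_off {k : Fin (n + 1)} {z z' : Fin (n + 1) → α × ℝ}
    {u : Fin n → α × ℝ} (hz : ∀ j, z (k.succAbove j) = u j) (hz' : ∀ j, z' (k.succAbove j) = u j) :
    |cellMean A z - cellMean A z'|
      ≤ A.indicator 1 (z k).1 * (|(z k).2 - cellMean A u| / (cellCount A u + 1))
        + A.indicator 1 (z' k).1 * (|(z' k).2 - cellMean A u| / (cellCount A u + 1)) := by
  have hu := cellCount_nonneg (A := A) u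
  rw [cellMean_succAbove k z, cellMean_succAbove k z']
  simp only [hz, hz']
  rw [add_sub_add_left_eq_sub]
  refine (abs_sub _ _).trans_eq ?_
  rw [abs_mul, abs_mul, abs_div, abs_div, abs_of_nonneg (indicator_one_nonneg A _),
    abs_of_nonneg (indicator_one_nonneg A _), abs_of_nonneg (add_nonneg hu zero_le_one)]

end Deterministic

variable [MeasurableSpace α]

theorem measurable_indicator_fst {A : Set α} (hA : MeasurableSet A) :
    Measurable fun z : α × ℝ => A.indicator (1 : α → ℝ) z.1 :=
  (measurable_one.indicator hA).comp measurable_fst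

theorem measurable_cellCount {A : Set α} (hA : MeasurableSet A) (n : ℕ) :
    Measurable (cellCount A : (Fin n → α × ℝ) → ℝ) :=
  Finset.measurable_sum _ fun k _ => (measurable_indicator_fst hA).comp (measurable_pi_apply k)

theorem measurable_cellMean {A : Set α} (hA : MeasurableSet A) (n : ℕ) :
    Measurable (cellMean A : (Fin n → α × ℝ) → ℝ) :=
  (Finset.measurable_sum _ fun k _ =>
    ((measurable_indicator_fst hA).comp (measurable_pi_apply k)).mul
      (measurable_snd.comp (measurable_pi_apply k))).div (measurable_cellCount hA n)

section Split

variable {E : Type*} [MeasurableSpace E] {Q : Measure E} [IsProbabilityMeasure Q] {m : ℕ}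

theorem lintegral_pi_succAbove_mul (k : Fin (m + 1)) {f : E → ENNReal} {g : (Fin m → E) → ENNReal}
    (hf : Measurable f) (hg : Measurable g) :
    ∫⁻ z, f (z k) * g (fun j => z (k.succAbove j)) ∂(Measure.pi fun _ : Fin (m + 1) => Q)
      = (∫⁻ z, f z ∂Q) * ∫⁻ z, g z ∂(Measure.pi fun _ : Fin m => Q) := by
  have h := measurePreserving_piFinSuccAbove (fun _ : Fin (m + 1) => Q) k
  rw [← lintegral_prod_mul hf.aemeasurable hg.aemeasurable,
    ← h.lintegral_comp (f := fun z : E × (Fin m → E) => f z.1 * g z.2) (by fun_prop)]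
  rfl

theorem lintegral_pi_prod_succAbove_mul (k : Fin (m + 1)) (p : Fin m → Prop) [DecidablePred p]
    {f : E × E → ENNReal} {g : (Fin m → E) → ENNReal} (hf : Measurable f) (hg : Measurable g) :
    ∫⁻ w, f (w k) * g (fun j => if p j then (w (k.succAbove j)).2 else (w (k.succAbove j)).1)
        ∂(Measure.pi fun _ : Fin (m + 1) => Q.prod Q)
      = (∫⁻ z, f z ∂(Q.prod Q)) * ∫⁻ z, g z ∂(Measure.pi fun _ : Fin m => Q) := by
  have h := measurePreserving_choose Q p
  rw [lintegral_pi_succAbove_mul (g := fun v : Fin m → E × E =>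
    g fun j => if p j then (v j).2 else (v j).1) k hf (hg.comp h.measurable)]
  rw [h.lintegral_comp hg]

end Split

variable {Q : Measure (α × ℝ)} [IsProbabilityMeasure Q] {A : Set α}

/-- Size biasing: a sum over the observations in a cell is reduced to a single observation. -/
theorem lintegral_sum_mul_cellCount (hA : MeasurableSet A) {m : ℕ} {φ : α × ℝ → ENNReal}
    {h : ℝ → ENNReal} (hφ : Measurable φ) (hφA : ∀ z, z.1 ∉ A → φ z = 0) (hh : Measurable h) :
    ∫⁻ z, (∑ k, φ (z k)) * h (cellCount A z) ∂(Measure.pi fun _ : Fin (m + 1) => Q)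
      = (m + 1) * (∫⁻ z, φ z ∂Q)
        * ∫⁻ z, h (1 + cellCount A z) ∂(Measure.pi fun _ : Fin m => Q) := by
  have hc := measurable_cellCount hA
  simp_rw [Finset.sum_mul]
  rw [lintegral_finsetSum]
  swap
  · intro k _
    exact (hφ.comp (measurable_pi_apply k)).mul (hh.comp (hc _))
  have : ∀ k : Fin (m + 1), ∫⁻ z, φ (z k) * h (cellCount A z)
        ∂(Measure.pi fun _ : Fin (m + 1) => Q)
      = (∫⁻ z, φ z ∂Q) * ∫⁻ z, h (1 + cellCount A z) ∂(Measure.pi fun _ : Fin m => Q) := by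
    intro k
    rw [← lintegral_pi_succAbove_mul (g := fun z => h (1 + cellCount A z)) k hφ
      (hh.comp ((hc _).const_add 1))]
    refine lintegral_congr fun z => ?_
    by_cases hz : (z k).1 ∈ A
    · rw [cellCount_succAbove k z, Set.indicator_of_mem hz]; rfl
    · rw [hφA _ hz, zero_mul, zero_mul]
  rw [Finset.sum_congr rfl fun k _ => this k, Finset.sum_const, Finset.card_univ, Fintype.card_fin,
    nsmul_eq_mul, mul_assoc]
  simp

theorem lintegral_indicator_fst {μ : Measure (α × ℝ)} (hA : MeasurableSet A) :
    ∫⁻ z, ENNReal.ofReal (A.indicator 1 z.1) ∂μ = μ (Prod.fst ⁻¹' A) := by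
  rw [← lintegral_indicator_one (measurable_fst hA)]
  refine lintegral_congr fun z => ?_
  by_cases h : z.1 ∈ A
  · rw [Set.indicator_of_mem h, Set.indicator_of_mem (show z ∈ Prod.fst ⁻¹' A from h)]; simp
  · rw [Set.indicator_of_notMem h, Set.indicator_of_notMem (show z ∉ Prod.fst ⁻¹' A from h)]; simp

theorem lintegral_cellCount_mul (hA : MeasurableSet A) (m : ℕ) {h : ℝ → ENNReal}
    (hh : Measurable h) :
    ∫⁻ z, ENNReal.ofReal (cellCount A z) * h (cellCount A z)
        ∂(Measure.pi fun _ : Fin (m + 1) => Q)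
      = (m + 1) * Q (Prod.fst ⁻¹' A)
        * ∫⁻ z, h (1 + cellCount A z) ∂(Measure.pi fun _ : Fin m => Q) := by
  rw [← lintegral_indicator_fst hA, ← lintegral_sum_mul_cellCount hA
    (measurable_indicator_fst hA).ennreal_ofReal (fun z hz => by simp [hz]) hh]
  simp_rw [cellCount, ENNReal.ofReal_sum_of_nonneg fun _ _ => indicator_one_nonneg A _]

/-- The second inverse moment of one plus a binomial variable. -/
theorem lintegral_inv_sq_cellCount_le (hA : MeasurableSet A) (m : ℕ) :
    (m + 1) ^ 2 * Q (Prod.fst ⁻¹' A) ^ 2 *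
      ∫⁻ z, ENNReal.ofReal (((cellCount A z + 1) ^ 2)⁻¹) ∂(Measure.pi fun _ : Fin m => Q) ≤ 2 := by
  -- Size biasing with `h x = x⁻¹`; the left side becomes the mean of `N * N⁻¹`, which is at most
  -- one.
  have h1 : ∀ m : ℕ, (m + 1) * Q (Prod.fst ⁻¹' A) *
      ∫⁻ z, ENNReal.ofReal ((1 + cellCount A z)⁻¹) ∂(Measure.pi fun _ : Fin m => Q) ≤ 1 := by
    intro m
    rw [← lintegral_cellCount_mul hA m (h := fun x => ENNReal.ofReal x⁻¹) (by fun_prop)]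
    refine (lintegral_mono fun z => ?_).trans_eq (by simp : ∫⁻ _, 1 ∂_ = 1)
    rw [← ENNReal.ofReal_mul (cellCount_nonneg z), ← ENNReal.ofReal_one]
    exact ENNReal.ofReal_le_ofReal mul_inv_le_one
  -- Size biasing with `h x = (x * (x + 1))⁻¹` trades one inverse factor for one more observation;
  -- `h1` then removes the other.
  have h2 : (m + 1) * Q (Prod.fst ⁻¹' A) *
      ∫⁻ z, ENNReal.ofReal (((1 + cellCount A z) * (1 + cellCount A z + 1))⁻¹)
        ∂(Measure.pi fun _ : Fin m => Q)
      ≤ ∫⁻ z, ENNReal.ofReal ((1 + cellCount A z)⁻¹)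
        ∂(Measure.pi fun _ : Fin (m + 1) => Q) := by
    rw [← lintegral_cellCount_mul hA m (h := fun x => ENNReal.ofReal (x * (x + 1))⁻¹)
      (by fun_prop)]
    refine lintegral_mono fun z => ?_
    rw [← ENNReal.ofReal_mul (cellCount_nonneg z)]
    refine ENNReal.ofReal_le_ofReal ?_
    rw [mul_inv, ← mul_assoc, add_comm 1]
    exact mul_le_of_le_one_left (inv_nonneg.2 (by linarith [cellCount_nonneg (A := A) z]))
      mul_inv_le_one
  -- The constant `2` comes from `N + 2 ≤ 2 (N + 1)`.
  have h3 : ∫⁻ z, ENNReal.ofReal (((cellCount A z + 1) ^ 2)⁻¹) ∂(Measure.pi fun _ : Fin m => Q)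
      ≤ 2 * ∫⁻ z, ENNReal.ofReal (((1 + cellCount A z) * (1 + cellCount A z + 1))⁻¹)
        ∂(Measure.pi fun _ : Fin m => Q) := by
    have hc := measurable_cellCount hA m
    rw [← lintegral_const_mul _ (by fun_prop)]
    refine lintegral_mono fun z => ?_
    have h0 := cellCount_nonneg (A := A) z
    rw [← ENNReal.ofReal_ofNat, ← ENNReal.ofReal_mul (by norm_num)]
    refine ENNReal.ofReal_le_ofReal ?_
    rw [← div_eq_mul_inv, inv_eq_one_div, div_le_div_iff₀ (by positivity) (by positivity)]
    nlinarith
  calc _ ≤ (m + 1) ^ 2 * Q (Prod.fst ⁻¹' A) ^ 2 * (2 *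
        ∫⁻ z, ENNReal.ofReal (((1 + cellCount A z) * (1 + cellCount A z + 1))⁻¹)
        ∂(Measure.pi fun _ : Fin m => Q)) := by gcongr
    _ = 2 * ((m + 1) * Q (Prod.fst ⁻¹' A) * ((m + 1) * Q (Prod.fst ⁻¹' A) *
        ∫⁻ z, ENNReal.ofReal (((1 + cellCount A z) * (1 + cellCount A z + 1))⁻¹)
        ∂(Measure.pi fun _ : Fin m => Q))) := by ring
    _ ≤ 2 * (((m + 1 : ℕ) + 1) * Q (Prod.fst ⁻¹' A) *
        ∫⁻ z, ENNReal.ofReal ((1 + cellCount A z)⁻¹)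
        ∂(Measure.pi fun _ : Fin (m + 1) => Q)) := by
      gcongr
      exact le_self_add
    _ ≤ 2 * 1 := by gcongr; exact h1 (m + 1)
    _ = 2 := mul_one 2

variable {B : ℝ}

/-- Bound the squared mean by the mean of squares, size bias down to one observation, replace its
squared response by `B`, and size bias back. The cell count is thus never decoupled from the mean by
independence. -/
theorem lintegral_sq_cellMean_le (hA : MeasurableSet A)
    (hB : ∫⁻ z, ENNReal.ofReal (A.indicator 1 z.1 * z.2 ^ 2) ∂Q
      ≤ ENNReal.ofReal B * Q (Prod.fst ⁻¹' A)) : ∀ m : ℕ,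
    ∫⁻ z, ENNReal.ofReal (cellMean A z ^ 2 * ((cellCount A z + 1) ^ 2)⁻¹)
        ∂(Measure.pi fun _ : Fin m => Q)
      ≤ ENNReal.ofReal B *
        ∫⁻ z, ENNReal.ofReal (((cellCount A z + 1) ^ 2)⁻¹) ∂(Measure.pi fun _ : Fin m => Q)
  | 0 => by simp [cellMean]
  | m + 1 => by
    set h : ℝ → ENNReal := fun x => ENNReal.ofReal (x⁻¹ * ((x + 1) ^ 2)⁻¹) with hh_def
    have hh : Measurable h := by fun_prop
    have hind := measurable_indicator_fst hA
    calc _ ≤ ∫⁻ z, (∑ k, ENNReal.ofReal (A.indicator 1 (z k).1 * (z k).2 ^ 2)) *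
          h (cellCount A z) ∂(Measure.pi fun _ : Fin (m + 1) => Q) := by
          refine lintegral_mono fun z => ?_
          have h0 := cellCount_nonneg (A := A) z
          have hn : ∀ k ∈ Finset.univ, 0 ≤ A.indicator (1 : α → ℝ) (z k).1 * (z k).2 ^ 2 :=
            fun k _ => mul_nonneg (indicator_one_nonneg A _) (sq_nonneg _)
          rw [← ENNReal.ofReal_sum_of_nonneg hn, hh_def,
            ← ENNReal.ofReal_mul (Finset.sum_nonneg hn), ← mul_assoc, ← div_eq_mul_inv]
          exact ENNReal.ofReal_le_ofReal
            (mul_le_mul_of_nonneg_right (sq_cellMean_le z) (by positivity))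
      _ = (m + 1) * (∫⁻ z, ENNReal.ofReal (A.indicator 1 z.1 * z.2 ^ 2) ∂Q) *
          ∫⁻ z, h (1 + cellCount A z) ∂(Measure.pi fun _ : Fin m => Q) :=
        lintegral_sum_mul_cellCount hA (φ := fun z => ENNReal.ofReal (A.indicator 1 z.1 * z.2 ^ 2))
          (by fun_prop) (fun z hz => by simp [hz]) hh
      _ ≤ (m + 1) * (ENNReal.ofReal B * Q (Prod.fst ⁻¹' A)) *
          ∫⁻ z, h (1 + cellCount A z) ∂(Measure.pi fun _ : Fin m => Q) := by gcongr
      _ = ENNReal.ofReal B * ((m + 1) * Q (Prod.fst ⁻¹' A) *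
          ∫⁻ z, h (1 + cellCount A z) ∂(Measure.pi fun _ : Fin m => Q)) := by ring
      _ ≤ _ := by
          rw [← lintegral_cellCount_mul hA m hh]
          gcongr with z
          have h0 := cellCount_nonneg (A := A) z
          rw [hh_def, ← ENNReal.ofReal_mul h0, ← mul_assoc]
          exact ENNReal.ofReal_le_ofReal (mul_le_of_le_one_left (by positivity) mul_inv_le_one)

end CellMean

/-! ### Covariance of the averages over two cells. -/

section CellCovariance

variable {α : Type*} [MeasurableSpace α] {Q : Measure (α × ℝ)} [IsProbabilityMeasure Q]
  {A A' : Set α} {B : ℝ}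

/-- Here `ψ` records which components of the `k`-th pair hit the cells and `η` picks a response.
Since `(η - T) ^ 2 ≤ 2 η ^ 2 + 2 T ^ 2` and the `k`-th pair is independent of the rest, each of the
two terms contributes `2 B c` times the inverse moment. -/
theorem lintegral_sq_sub_cellMean_le (hA : MeasurableSet A)
    (hB : ∫⁻ z, ENNReal.ofReal (A.indicator 1 z.1 * z.2 ^ 2) ∂Q
      ≤ ENNReal.ofReal B * Q (Prod.fst ⁻¹' A)) {m : ℕ} (k : Fin (m + 1))
    (p : Fin m → Prop) [DecidablePred p] {ψ η : (α × ℝ) × (α × ℝ) → ℝ} (hψ : Measurable ψ)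
    (hη : Measurable η) (hψ0 : ∀ v, 0 ≤ ψ v) {c : ENNReal}
    (hc : ∫⁻ v, ENNReal.ofReal (ψ v) ∂(Q.prod Q) ≤ c)
    (hcB : ∫⁻ v, ENNReal.ofReal (ψ v * η v ^ 2) ∂(Q.prod Q) ≤ ENNReal.ofReal B * c) :
    ∫⁻ w, ENNReal.ofReal (ψ (w k) *
        (|η (w k) - cellMean A
            (fun j => if p j then (w (k.succAbove j)).2 else (w (k.succAbove j)).1)|
          / (cellCount A (fun j => if p j then (w (k.succAbove j)).2 else (w (k.succAbove j)).1)
            + 1)) ^ 2) ∂(Measure.pi fun _ : Fin (m + 1) => Q.prod Q)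
      ≤ 4 * ENNReal.ofReal B * c *
        ∫⁻ z, ENNReal.ofReal (((cellCount A z + 1) ^ 2)⁻¹) ∂(Measure.pi fun _ : Fin m => Q) := by
  have hN := measurable_cellCount hA m
  have hT := measurable_cellMean hA m
  set e := ∫⁻ z, ENNReal.ofReal (((cellCount A z + 1) ^ 2)⁻¹) ∂(Measure.pi fun _ : Fin m => Q)
  have hψη : Measurable fun v => ψ v * η v ^ 2 := hψ.mul (hη.pow_const 2)
  let f1 : (α × ℝ) × (α × ℝ) → ENNReal := fun v => ENNReal.ofReal (ψ v * η v ^ 2)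
  let f2 : (α × ℝ) × (α × ℝ) → ENNReal := fun v => ENNReal.ofReal (ψ v)
  let g1 : (Fin m → α × ℝ) → ENNReal := fun z => ENNReal.ofReal (((cellCount A z + 1) ^ 2)⁻¹)
  let g2 : (Fin m → α × ℝ) → ENNReal :=
    fun z => ENNReal.ofReal (cellMean A z ^ 2 * ((cellCount A z + 1) ^ 2)⁻¹)
  have mf1 : Measurable f1 := hψη.ennreal_ofReal
  have mf2 : Measurable f2 := hψ.ennreal_ofReal
  have mg1 : Measurable g1 := by fun_prop
  have mg2 : Measurable g2 := by fun_prop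
  let u : (Fin (m + 1) → (α × ℝ) × (α × ℝ)) → Fin m → α × ℝ :=
    fun w j => if p j then (w (k.succAbove j)).2 else (w (k.succAbove j)).1
  have mu : Measurable u := by
    refine measurable_pi_iff.2 fun j => ?_
    by_cases h : p j
    · simp only [u, h, if_true]; fun_prop
    · simp only [u, h, if_false]; fun_prop
  have m1 : Measurable fun w : Fin (m + 1) → (α × ℝ) × (α × ℝ) => f1 (w k) * g1 (u w) :=
    (mf1.comp (measurable_pi_apply k)).mul (mg1.comp mu)
  have m2 : Measurable fun w : Fin (m + 1) → (α × ℝ) × (α × ℝ) => f2 (w k) * g2 (u w) :=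
    (mf2.comp (measurable_pi_apply k)).mul (mg2.comp mu)
  calc _ ≤ ∫⁻ w, (2 * (f1 (w k) * g1 (u w)) + 2 * (f2 (w k) * g2 (u w)))
        ∂(Measure.pi fun _ : Fin (m + 1) => Q.prod Q) := by
        refine lintegral_mono fun w => ?_
        have h0 := cellCount_nonneg (A := A) (u w)
        change ENNReal.ofReal (ψ (w k) * (|η (w k) - cellMean A (u w)|
          / (cellCount A (u w) + 1)) ^ 2) ≤ _
        have hψw := hψ0 (w k)
        simp only [f1, f2, g1, g2]
        rw [← ENNReal.ofReal_mul (by positivity), ← ENNReal.ofReal_mul (by positivity),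
          ← ENNReal.ofReal_ofNat, ← ENNReal.ofReal_mul (by positivity),
          ← ENNReal.ofReal_mul (by positivity), ← ENNReal.ofReal_add (by positivity)
          (by positivity)]
        refine ENNReal.ofReal_le_ofReal ?_
        rw [div_pow, sq_abs, div_eq_mul_inv]
        have hk : 0 ≤ ψ (w k) * ((cellCount A (u w) + 1) ^ 2)⁻¹ := by positivity
        nlinarith [mul_nonneg hk (sq_nonneg (η (w k) + cellMean A (u w)))]
    _ = 2 * ((∫⁻ v, f1 v ∂(Q.prod Q)) * e) + 2 * ((∫⁻ v, f2 v ∂(Q.prod Q)) *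
        ∫⁻ z, g2 z ∂(Measure.pi fun _ : Fin m => Q)) := by
        rw [lintegral_add_left (by fun_prop), lintegral_const_mul _ m1, lintegral_const_mul _ m2,
          lintegral_pi_prod_succAbove_mul k p mf1 mg1,
          lintegral_pi_prod_succAbove_mul k p mf2 mg2]
    _ ≤ 2 * ((ENNReal.ofReal B * c) * e) + 2 * (c * (ENNReal.ofReal B * e)) := by
        gcongr
        exact lintegral_sq_cellMean_le hA hB m
    _ = _ := by ring

theorem lintegral_add_add_add {Ω : Type*} [MeasurableSpace Ω] {μ : Measure Ω}
    {a b c d : Ω → ENNReal} (ha : Measurable a) (hb : Measurable b) (hc : Measurable c) :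
    ∫⁻ x, ((a x + b x) + (c x + d x)) ∂μ
      = (∫⁻ x, a x ∂μ + ∫⁻ x, b x ∂μ) + (∫⁻ x, c x ∂μ + ∫⁻ x, d x ∂μ) := by
  rw [lintegral_add_left (f := fun x => a x + b x) (ha.add hb), lintegral_add_left ha,
    lintegral_add_left hc]

/-- Each of the four cross terms is split by `2 a b ≤ a ^ 2 + b ^ 2`. The two increments involve
dependent samples, and after the split no joint moment of them is needed. -/
theorem two_mul_mul_le_of_le {F G I I' J J' a a' b b' : ℝ} (hF : F ≤ I * a + I' * a')
    (hG : G ≤ J * b + J' * b') (hG0 : 0 ≤ G) (hI : 0 ≤ I) (hI' : 0 ≤ I') (hJ : 0 ≤ J)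
    (hJ' : 0 ≤ J') (ha : 0 ≤ a) (ha' : 0 ≤ a') :
    2 * (F * G) ≤ ((I * J * a ^ 2 + I * J * b ^ 2) + (I' * J' * a' ^ 2 + I' * J' * b' ^ 2))
      + ((I * J' * a ^ 2 + I * J' * b' ^ 2) + (I' * J * a' ^ 2 + I' * J * b ^ 2)) := by
  have h : F * G ≤ (I * a + I' * a') * (J * b + J' * b') :=
    mul_le_mul hF hG hG0 (by positivity)
  nlinarith [mul_nonneg (mul_nonneg hI hJ) (sq_nonneg (a - b)),
    mul_nonneg (mul_nonneg hI' hJ') (sq_nonneg (a' - b')),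
    mul_nonneg (mul_nonneg hI hJ') (sq_nonneg (a - b')),
    mul_nonneg (mul_nonneg hI' hJ) (sq_nonneg (a' - b))]

/-- Both cells are hit by the `k`-th pair either through one component (weights `ψ1`, `ψ2`, mass
`q`) or through different ones (`ψ3`, `ψ4`, mass `P * P'`). Two weights of each kind, at `4 B`
apiece, make the factor `8`. -/
theorem lintegral_increments_le (hA : MeasurableSet A) (hA' : MeasurableSet A')
    (hB : ∀ S, MeasurableSet S → ∫⁻ z, ENNReal.ofReal (S.indicator 1 z.1 * z.2 ^ 2) ∂Q
      ≤ ENNReal.ofReal B * Q (Prod.fst ⁻¹' S)) {m : ℕ} (k : Fin (m + 1)) :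
    ∫⁻ w, ENNReal.ofReal (2 * (|cellMean A (hybrid 0 w) - cellMean A (exchangeAt k w)|
        * |cellMean A' (hybrid k w) - cellMean A' (hybrid (k + 1) w)|))
        ∂(Measure.pi fun _ : Fin (m + 1) => Q.prod Q)
      ≤ 8 * ENNReal.ofReal B *
        (Q (Prod.fst ⁻¹' (A ∩ A')) + Q (Prod.fst ⁻¹' A) * Q (Prod.fst ⁻¹' A')) *
        (∫⁻ z, ENNReal.ofReal (((cellCount A z + 1) ^ 2)⁻¹) ∂(Measure.pi fun _ : Fin m => Q)
        + ∫⁻ z, ENNReal.ofReal (((cellCount A' z + 1) ^ 2)⁻¹)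
          ∂(Measure.pi fun _ : Fin m => Q)) := by
  have hq : ∀ x, A.indicator (1 : α → ℝ) x * A'.indicator 1 x = (A ∩ A').indicator 1 x := by
    intro x
    by_cases h : x ∈ A <;> by_cases h' : x ∈ A' <;> simp [h, h']
  have iA : Measurable fun z : α × ℝ => A.indicator (1 : α → ℝ) z.1 := measurable_indicator_fst hA
  have iA' : Measurable fun z : α × ℝ => A'.indicator (1 : α → ℝ) z.1 :=
    measurable_indicator_fst hA'
  have iq := measurable_indicator_fst (hA.inter hA')
  have nA := indicator_one_nonneg A
  have nA' := indicator_one_nonneg A'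
  set P := Q (Prod.fst ⁻¹' A)
  set P' := Q (Prod.fst ⁻¹' A')
  set q := Q (Prod.fst ⁻¹' (A ∩ A'))
  set e := ∫⁻ z, ENNReal.ofReal (((cellCount A z + 1) ^ 2)⁻¹) ∂(Measure.pi fun _ : Fin m => Q)
  set e' := ∫⁻ z, ENNReal.ofReal (((cellCount A' z + 1) ^ 2)⁻¹)
    ∂(Measure.pi fun _ : Fin m => Q)
  -- the four weights
  let ψ1 : (α × ℝ) × (α × ℝ) → ℝ := fun v => A.indicator 1 v.1.1 * A'.indicator 1 v.1.1
  let ψ2 : (α × ℝ) × (α × ℝ) → ℝ := fun v => A.indicator 1 v.2.1 * A'.indicator 1 v.2.1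
  let ψ3 : (α × ℝ) × (α × ℝ) → ℝ := fun v => A.indicator 1 v.1.1 * A'.indicator 1 v.2.1
  let ψ4 : (α × ℝ) × (α × ℝ) → ℝ := fun v => A.indicator 1 v.2.1 * A'.indicator 1 v.1.1
  have mψ1 : Measurable ψ1 := (iA.comp measurable_fst).mul (iA'.comp measurable_fst)
  have mψ2 : Measurable ψ2 := (iA.comp measurable_snd).mul (iA'.comp measurable_snd)
  have mψ3 : Measurable ψ3 := (iA.comp measurable_fst).mul (iA'.comp measurable_snd)
  have mψ4 : Measurable ψ4 := (iA.comp measurable_snd).mul (iA'.comp measurable_fst)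
  have c1 : ∫⁻ v, ENNReal.ofReal (ψ1 v) ∂(Q.prod Q) ≤ q := by
    simp only [ψ1, hq]
    rw [measurePreserving_fst.lintegral_comp
      (f := fun z : α × ℝ => ENNReal.ofReal ((A ∩ A').indicator 1 z.1)) (by fun_prop),
      lintegral_indicator_fst (hA.inter hA')]
  have c2 : ∫⁻ v, ENNReal.ofReal (ψ2 v) ∂(Q.prod Q) ≤ q := by
    simp only [ψ2, hq]
    rw [measurePreserving_snd.lintegral_comp
      (f := fun z : α × ℝ => ENNReal.ofReal ((A ∩ A').indicator 1 z.1)) (by fun_prop),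
      lintegral_indicator_fst (hA.inter hA')]
  have c3 : ∫⁻ v, ENNReal.ofReal (ψ3 v) ∂(Q.prod Q) ≤ P * P' := by
    simp only [ψ3, ENNReal.ofReal_mul (nA _)]
    rw [lintegral_prod_mul (f := fun z : α × ℝ => ENNReal.ofReal (A.indicator 1 z.1))
      (g := fun z : α × ℝ => ENNReal.ofReal (A'.indicator 1 z.1)) (by fun_prop) (by fun_prop),
      lintegral_indicator_fst hA, lintegral_indicator_fst hA']
  have c4 : ∫⁻ v, ENNReal.ofReal (ψ4 v) ∂(Q.prod Q) ≤ P * P' := by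
    simp only [ψ4, ENNReal.ofReal_mul (nA _), mul_comm (ENNReal.ofReal (A.indicator _ _))]
    rw [lintegral_prod_mul (f := fun z : α × ℝ => ENNReal.ofReal (A'.indicator 1 z.1))
      (g := fun z : α × ℝ => ENNReal.ofReal (A.indicator 1 z.1)) (by fun_prop) (by fun_prop),
      lintegral_indicator_fst hA, lintegral_indicator_fst hA', mul_comm]
  have d1 : ∫⁻ v, ENNReal.ofReal (ψ1 v * v.1.2 ^ 2) ∂(Q.prod Q) ≤ ENNReal.ofReal B * q := by
    simp only [ψ1, hq]
    rw [measurePreserving_fst.lintegral_comp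
      (f := fun z : α × ℝ => ENNReal.ofReal ((A ∩ A').indicator 1 z.1 * z.2 ^ 2)) (by fun_prop)]
    exact hB _ (hA.inter hA')
  have d2 : ∫⁻ v, ENNReal.ofReal (ψ2 v * v.2.2 ^ 2) ∂(Q.prod Q) ≤ ENNReal.ofReal B * q := by
    simp only [ψ2, hq]
    rw [measurePreserving_snd.lintegral_comp
      (f := fun z : α × ℝ => ENNReal.ofReal ((A ∩ A').indicator 1 z.1 * z.2 ^ 2)) (by fun_prop)]
    exact hB _ (hA.inter hA')
  have hprod : ∀ {S S' : Set α}, MeasurableSet S → MeasurableSet S' →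
      ∫⁻ v, ENNReal.ofReal (S.indicator 1 v.1.1 * S'.indicator 1 v.2.1 * v.1.2 ^ 2) ∂(Q.prod Q)
        ≤ ENNReal.ofReal B * (Q (Prod.fst ⁻¹' S) * Q (Prod.fst ⁻¹' S')) := by
    intro S S' hS hS'
    have iS := measurable_indicator_fst hS
    have iS' := measurable_indicator_fst hS'
    simp only [mul_right_comm _ (S'.indicator (1 : α → ℝ) _),
      ENNReal.ofReal_mul (mul_nonneg (indicator_one_nonneg S _) (sq_nonneg _))]
    rw [lintegral_prod_mul (f := fun z : α × ℝ => ENNReal.ofReal (S.indicator 1 z.1 * z.2 ^ 2))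
      (g := fun z : α × ℝ => ENNReal.ofReal (S'.indicator 1 z.1)) (by fun_prop) (by fun_prop),
      lintegral_indicator_fst hS', ← mul_assoc]
    gcongr
    exact hB S hS
  have hprod' : ∀ {S S' : Set α}, MeasurableSet S → MeasurableSet S' →
      ∫⁻ v, ENNReal.ofReal (S.indicator 1 v.1.1 * S'.indicator 1 v.2.1 * v.2.2 ^ 2) ∂(Q.prod Q)
        ≤ ENNReal.ofReal B * (Q (Prod.fst ⁻¹' S) * Q (Prod.fst ⁻¹' S')) := by
    intro S S' hS hS'
    have iS := measurable_indicator_fst hS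
    have iS' := measurable_indicator_fst hS'
    have h := (Measure.measurePreserving_swap (μ := Q) (ν := Q)).lintegral_comp
      (f := fun v : (α × ℝ) × (α × ℝ) => ENNReal.ofReal (S.indicator 1 v.1.1 *
        S'.indicator 1 v.2.1 * v.2.2 ^ 2)) (by fun_prop)
    rw [← h, mul_comm (Q _)]
    refine le_of_eq_of_le (lintegral_congr fun v => ?_) (hprod hS' hS)
    simp only [Prod.fst_swap, Prod.snd_swap, mul_comm (S.indicator (1 : α → ℝ) _)]
  have d3 : ∫⁻ v, ENNReal.ofReal (ψ3 v * v.1.2 ^ 2) ∂(Q.prod Q) ≤ ENNReal.ofReal B * (P * P') :=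
    hprod hA hA'
  have d3' : ∫⁻ v, ENNReal.ofReal (ψ3 v * v.2.2 ^ 2) ∂(Q.prod Q) ≤ ENNReal.ofReal B * (P * P') :=
    hprod' hA hA'
  have d4 : ∫⁻ v, ENNReal.ofReal (ψ4 v * v.2.2 ^ 2) ∂(Q.prod Q)
      ≤ ENNReal.ofReal B * (P * P') := by
    rw [mul_comm P]
    refine le_of_eq_of_le (lintegral_congr fun v => ?_) (hprod' hA' hA)
    simp only [ψ4, mul_comm (A.indicator (1 : α → ℝ) _)]
  have d4' : ∫⁻ v, ENNReal.ofReal (ψ4 v * v.1.2 ^ 2) ∂(Q.prod Q)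
      ≤ ENNReal.ofReal B * (P * P') := by
    rw [mul_comm P]
    refine le_of_eq_of_le (lintegral_congr fun v => ?_) (hprod hA' hA)
    simp only [ψ4, mul_comm (A.indicator (1 : α → ℝ) _)]
  -- the unchanged part of the samples
  let u : (Fin (m + 1) → (α × ℝ) × (α × ℝ)) → Fin m → α × ℝ := fun w j =>
    if (k.succAbove j : ℕ) < 0 then (w (k.succAbove j)).2 else (w (k.succAbove j)).1
  let u' : (Fin (m + 1) → (α × ℝ) × (α × ℝ)) → Fin m → α × ℝ := fun w j =>
    if (k.succAbove j : ℕ) < k then (w (k.succAbove j)).2 else (w (k.succAbove j)).1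
  let s : ((α × ℝ) × (α × ℝ) → ℝ) → ((α × ℝ) × (α × ℝ) → ℝ) →
      (Fin (m + 1) → (α × ℝ) × (α × ℝ)) → ℝ := fun ψ η w =>
    ψ (w k) * (|η (w k) - cellMean A (u w)| / (cellCount A (u w) + 1)) ^ 2
  let s' : ((α × ℝ) × (α × ℝ) → ℝ) → ((α × ℝ) × (α × ℝ) → ℝ) →
      (Fin (m + 1) → (α × ℝ) × (α × ℝ)) → ℝ := fun ψ η w =>
    ψ (w k) * (|η (w k) - cellMean A' (u' w)| / (cellCount A' (u' w) + 1)) ^ 2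
  let y1 : (α × ℝ) × (α × ℝ) → ℝ := fun v => v.1.2
  let y2 : (α × ℝ) × (α × ℝ) → ℝ := fun v => v.2.2
  have my1 : Measurable y1 := by fun_prop
  have my2 : Measurable y2 := by fun_prop
  have key : ∀ w, 2 * (|cellMean A (hybrid 0 w) - cellMean A (exchangeAt k w)|
        * |cellMean A' (hybrid k w) - cellMean A' (hybrid (k + 1) w)|)
      ≤ ((s ψ1 y1 w + s' ψ1 y1 w) + (s ψ2 y2 w + s' ψ2 y2 w))
        + ((s ψ3 y1 w + s' ψ3 y2 w) + (s ψ4 y2 w + s' ψ4 y1 w)) := by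
    intro w
    have hne : ∀ j, k.succAbove j ≠ k := fun j => k.succAbove_ne j
    have hF := cellMean_sub_of_eq_off (A := A) (k := k) (z := hybrid 0 w) (z' := exchangeAt k w)
      (u := u w) (fun j => rfl) (fun j => by simp [u, exchangeAt, hne j])
    -- Off entry `k`, the conditions `j < k + 1` and `j < k` agree, so both hybrids have the same
    -- remaining sample `u'`.
    have hG := cellMean_sub_of_eq_off (A := A') (k := k) (z := hybrid k w)
      (z' := hybrid (k + 1) w) (u := u' w) (fun j => rfl) (fun j => by
        have := Fin.val_ne_of_ne (hne j)
        have h : ((k.succAbove j : ℕ) < k + 1) ↔ (k.succAbove j : ℕ) < k := by omega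
        simp only [hybrid, u', h])
    have hN := cellCount_nonneg (A := A) (u w)
    have e1 : hybrid 0 w k = (w k).1 := by simp [hybrid]
    have e2 : exchangeAt k w k = (w k).2 := by simp [exchangeAt]
    have e3 : hybrid k w k = (w k).1 := by simp [hybrid]
    have e4 : hybrid (k + 1) w k = (w k).2 := by simp [hybrid]
    rw [e1, e2] at hF
    rw [e3, e4] at hG
    exact two_mul_mul_le_of_le hF hG (abs_nonneg _) (nA _) (nA _) (nA' _) (nA' _)
      (by positivity) (by positivity)
  have hs : ∀ {ψ η : (α × ℝ) × (α × ℝ) → ℝ} {c : ENNReal}, Measurable ψ → Measurable η →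
      (∀ v, 0 ≤ ψ v) → ∫⁻ v, ENNReal.ofReal (ψ v) ∂(Q.prod Q) ≤ c →
      ∫⁻ v, ENNReal.ofReal (ψ v * η v ^ 2) ∂(Q.prod Q) ≤ ENNReal.ofReal B * c →
      ∫⁻ w, ENNReal.ofReal (s ψ η w) ∂(Measure.pi fun _ : Fin (m + 1) => Q.prod Q)
        ≤ 4 * ENNReal.ofReal B * c * e := fun hψ hη h0 hc hcB =>
    lintegral_sq_sub_cellMean_le hA (hB A hA) k (fun j => (k.succAbove j : ℕ) < 0) hψ hη h0 hc hcB
  have hs' : ∀ {ψ η : (α × ℝ) × (α × ℝ) → ℝ} {c : ENNReal}, Measurable ψ → Measurable η →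
      (∀ v, 0 ≤ ψ v) → ∫⁻ v, ENNReal.ofReal (ψ v) ∂(Q.prod Q) ≤ c →
      ∫⁻ v, ENNReal.ofReal (ψ v * η v ^ 2) ∂(Q.prod Q) ≤ ENNReal.ofReal B * c →
      ∫⁻ w, ENNReal.ofReal (s' ψ η w) ∂(Measure.pi fun _ : Fin (m + 1) => Q.prod Q)
        ≤ 4 * ENNReal.ofReal B * c * e' := fun hψ hη h0 hc hcB =>
    lintegral_sq_sub_cellMean_le hA' (hB A' hA') k (fun j => (k.succAbove j : ℕ) < k)
      hψ hη h0 hc hcB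
  have n1 : ∀ v, 0 ≤ ψ1 v := fun v => mul_nonneg (nA _) (nA' _)
  have n2 : ∀ v, 0 ≤ ψ2 v := fun v => mul_nonneg (nA _) (nA' _)
  have n3 : ∀ v, 0 ≤ ψ3 v := fun v => mul_nonneg (nA _) (nA' _)
  have n4 : ∀ v, 0 ≤ ψ4 v := fun v => mul_nonneg (nA _) (nA' _)
  have hu : Measurable u := by
    refine measurable_pi_iff.2 fun j => ?_
    simp only [u, Nat.not_lt_zero, if_false]
    fun_prop
  have hu' : Measurable u' := by
    refine measurable_pi_iff.2 fun j => ?_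
    by_cases h : (k.succAbove j : ℕ) < k
    · simp only [u', h, if_true]; fun_prop
    · simp only [u', h, if_false]; fun_prop
  have hm : ∀ {ψ η : (α × ℝ) × (α × ℝ) → ℝ}, Measurable ψ → Measurable η →
      Measurable fun w => ENNReal.ofReal (s ψ η w) := by
    intro ψ η hψ hη
    have h1 := (measurable_cellMean hA m).comp hu
    have h2 := (measurable_cellCount hA m).comp hu
    exact ((hψ.comp (measurable_pi_apply k)).mul (((continuous_abs.measurable.comp
      ((hη.comp (measurable_pi_apply k)).sub h1)).div (h2.add_const 1)).pow_const 2)).ennreal_ofReal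
  have hm' : ∀ {ψ η : (α × ℝ) × (α × ℝ) → ℝ}, Measurable ψ → Measurable η →
      Measurable fun w => ENNReal.ofReal (s' ψ η w) := by
    intro ψ η hψ hη
    have h1 := (measurable_cellMean hA' m).comp hu'
    have h2 := (measurable_cellCount hA' m).comp hu'
    exact ((hψ.comp (measurable_pi_apply k)).mul (((continuous_abs.measurable.comp
      ((hη.comp (measurable_pi_apply k)).sub h1)).div (h2.add_const 1)).pow_const 2)).ennreal_ofReal
  calc _ ≤ ∫⁻ w, (((ENNReal.ofReal (s ψ1 y1 w) + ENNReal.ofReal (s' ψ1 y1 w))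
          + (ENNReal.ofReal (s ψ2 y2 w) + ENNReal.ofReal (s' ψ2 y2 w)))
        + ((ENNReal.ofReal (s ψ3 y1 w) + ENNReal.ofReal (s' ψ3 y2 w))
          + (ENNReal.ofReal (s ψ4 y2 w) + ENNReal.ofReal (s' ψ4 y1 w))))
        ∂(Measure.pi fun _ : Fin (m + 1) => Q.prod Q) := by
        refine lintegral_mono fun w => ((ENNReal.ofReal_le_ofReal (key w)).trans ?_)
        refine ENNReal.ofReal_add_le.trans (add_le_add ?_ ?_) <;>
        exact ENNReal.ofReal_add_le.trans (add_le_add ENNReal.ofReal_add_le ENNReal.ofReal_add_le)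
    _ = ((∫⁻ w, ENNReal.ofReal (s ψ1 y1 w) ∂(Measure.pi fun _ : Fin (m + 1) => Q.prod Q)
          + ∫⁻ w, ENNReal.ofReal (s' ψ1 y1 w) ∂(Measure.pi fun _ : Fin (m + 1) => Q.prod Q))
          + (∫⁻ w, ENNReal.ofReal (s ψ2 y2 w) ∂(Measure.pi fun _ : Fin (m + 1) => Q.prod Q)
          + ∫⁻ w, ENNReal.ofReal (s' ψ2 y2 w) ∂(Measure.pi fun _ : Fin (m + 1) => Q.prod Q)))
        + ((∫⁻ w, ENNReal.ofReal (s ψ3 y1 w) ∂(Measure.pi fun _ : Fin (m + 1) => Q.prod Q)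
          + ∫⁻ w, ENNReal.ofReal (s' ψ3 y2 w) ∂(Measure.pi fun _ : Fin (m + 1) => Q.prod Q))
          + (∫⁻ w, ENNReal.ofReal (s ψ4 y2 w) ∂(Measure.pi fun _ : Fin (m + 1) => Q.prod Q)
          + ∫⁻ w, ENNReal.ofReal (s' ψ4 y1 w)
            ∂(Measure.pi fun _ : Fin (m + 1) => Q.prod Q))) := by
        rw [lintegral_add_left (f := fun w =>
            (ENNReal.ofReal (s ψ1 y1 w) + ENNReal.ofReal (s' ψ1 y1 w))
            + (ENNReal.ofReal (s ψ2 y2 w) + ENNReal.ofReal (s' ψ2 y2 w)))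
            (((hm mψ1 my1).add (hm' mψ1 my1)).add ((hm mψ2 my2).add (hm' mψ2 my2))),
          lintegral_add_add_add (hm mψ1 my1) (hm' mψ1 my1) (hm mψ2 my2),
          lintegral_add_add_add (hm mψ3 my1) (hm' mψ3 my2) (hm mψ4 my2)]
    _ ≤ ((4 * ENNReal.ofReal B * q * e + 4 * ENNReal.ofReal B * q * e')
          + (4 * ENNReal.ofReal B * q * e + 4 * ENNReal.ofReal B * q * e'))
        + ((4 * ENNReal.ofReal B * (P * P') * e + 4 * ENNReal.ofReal B * (P * P') * e')
          + (4 * ENNReal.ofReal B * (P * P') * e + 4 * ENNReal.ofReal B * (P * P') * e')) := by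
        gcongr
        · exact hs mψ1 my1 n1 c1 d1
        · exact hs' mψ1 my1 n1 c1 d1
        · exact hs mψ2 my2 n2 c2 d2
        · exact hs' mψ2 my2 n2 c2 d2
        · exact hs mψ3 my1 n3 c3 d3
        · exact hs' mψ3 my2 n3 c3 d3'
        · exact hs mψ4 my2 n4 c4 d4
        · exact hs' mψ4 my1 n4 c4 d4'
    _ = _ := by ring

theorem memLp_cellMean (hY : MemLp Prod.snd 2 Q) (hA : MeasurableSet A) (n : ℕ) :
    MemLp (cellMean A) 2 (Measure.pi fun _ : Fin n => Q) := by
  have h : MemLp (fun z : Fin n → α × ℝ => ∑ k, |(z k).2|) 2 (Measure.pi fun _ : Fin n => Q) :=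
    memLp_finsetSum _ fun k _ =>
      (hY.comp_measurePreserving (measurePreserving_eval (fun _ : Fin n => Q) k)).abs
  refine h.mono (measurable_cellMean hA n).aestronglyMeasurable (.of_forall fun z => ?_)
  rw [Real.norm_eq_abs, Real.norm_of_nonneg (Finset.sum_nonneg fun _ _ => abs_nonneg _)]
  exact abs_cellMean_le z

/-- The covariance of the averages over two cells of the same probability `p`. -/
theorem abs_covariance_cellMean_le (hA : MeasurableSet A) (hA' : MeasurableSet A') (hB0 : 0 ≤ B)
    (hB : ∀ S, MeasurableSet S → ∫⁻ z, ENNReal.ofReal (S.indicator 1 z.1 * z.2 ^ 2) ∂Q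
      ≤ ENNReal.ofReal B * Q (Prod.fst ⁻¹' S)) (hY : MemLp Prod.snd 2 Q) {p : ℝ} (hp : 0 < p)
    (hAp : Q (Prod.fst ⁻¹' A) = ENNReal.ofReal p) (hAp' : Q (Prod.fst ⁻¹' A') = ENNReal.ofReal p)
    {n : ℕ} (hn : 0 < n) :
    |∫ z, cellMean A z * cellMean A' z ∂(Measure.pi fun _ : Fin n => Q)
        - (∫ z, cellMean A z ∂(Measure.pi fun _ : Fin n => Q))
          * ∫ z, cellMean A' z ∂(Measure.pi fun _ : Fin n => Q)|
      ≤ 8 * B * (Q.real (Prod.fst ⁻¹' (A ∩ A')) + p ^ 2) / (n * p ^ 2) := by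
  obtain ⟨m, rfl⟩ : ∃ m, n = m + 1 := ⟨n - 1, by omega⟩
  have hF := memLp_cellMean hY hA (m + 1)
  have hG := memLp_cellMean hY hA' (m + 1)
  refine (abs_integral_mul_sub_le hF hG).trans ?_
  set q := Q.real (Prod.fst ⁻¹' (A ∩ A')) with hq
  have hq' : Q (Prod.fst ⁻¹' (A ∩ A')) = ENNReal.ofReal q := by
    rw [hq, measureReal_def, ENNReal.ofReal_toReal (measure_ne_top _ _)]
  have hq0 : 0 ≤ q := measureReal_nonneg
  have hk : ∀ k : Fin (m + 1), (∫ w, |cellMean A (hybrid 0 w) - cellMean A (exchangeAt k w)|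
      * |cellMean A' (hybrid k w) - cellMean A' (hybrid (k + 1) w)|
        ∂(Measure.pi fun _ => Q.prod Q)) / 2
      ≤ 8 * B * (q + p ^ 2) / ((m + 1) ^ 2 * p ^ 2) := by
    intro k
    set I := ∫ w, |cellMean A (hybrid 0 w) - cellMean A (exchangeAt k w)|
      * |cellMean A' (hybrid k w) - cellMean A' (hybrid (k + 1) w)|
        ∂(Measure.pi fun _ => Q.prod Q) with hI
    have hint : Integrable (fun w => |cellMean A (hybrid 0 w) - cellMean A (exchangeAt k w)|
      * |cellMean A' (hybrid k w) - cellMean A' (hybrid (k + 1) w)|)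
        (Measure.pi fun _ => Q.prod Q) :=
      ((hF.comp_measurePreserving (measurePreserving_hybrid Q 0)).sub
        (hF.comp_measurePreserving (measurePreserving_exchangeAt Q k))).abs.integrable_mul
      ((hG.comp_measurePreserving (measurePreserving_hybrid Q k)).sub
        (hG.comp_measurePreserving (measurePreserving_hybrid Q (k + 1)))).abs
    have h1 := lintegral_increments_le hA hA' hB k
    rw [← ofReal_integral_eq_lintegral_ofReal (hint.const_mul 2)
      (.of_forall fun w => by positivity), integral_const_mul, ← hI, hq', hAp, hAp'] at h1
    have h2 := lintegral_inv_sq_cellCount_le (Q := Q) hA m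
    have h2' := lintegral_inv_sq_cellCount_le (Q := Q) hA' m
    rw [hAp] at h2
    rw [hAp'] at h2'
    -- Each cell's second inverse moment contributes one `2`. So `2 * I` is at most `32 B (q + p ^
    -- 2) / (n p) ^ 2`, whence the `8` for `I / 2`.
    have h3 : ((m : ENNReal) + 1) ^ 2 * ENNReal.ofReal p ^ 2 * ENNReal.ofReal (2 * I)
        ≤ 8 * ENNReal.ofReal B * (ENNReal.ofReal q + ENNReal.ofReal p * ENNReal.ofReal p)
          * (2 + 2) := by
      refine (mul_le_mul_right h1 _).trans ?_
      rw [mul_left_comm]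
      gcongr
      rw [mul_add]
      exact add_le_add h2 h2'
    have h4 : ENNReal.ofReal (((m : ℝ) + 1) ^ 2 * p ^ 2 * (2 * I))
        ≤ ENNReal.ofReal (8 * B * (q + p * p) * (2 + 2)) := by
      have hm : (m : ENNReal) + 1 = ENNReal.ofReal ((m : ℝ) + 1) := by
        rw [ENNReal.ofReal_add (by positivity) zero_le_one]; simp
      have h8 : (8 : ENNReal) = ENNReal.ofReal 8 := by simp
      have h22 : (2 + 2 : ENNReal) = ENNReal.ofReal (2 + 2) := by
        rw [ENNReal.ofReal_add (by norm_num) (by norm_num)]; simp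
      rwa [hm, h8, h22, ← ENNReal.ofReal_pow (by positivity), ← ENNReal.ofReal_pow hp.le,
        ← ENNReal.ofReal_mul (by positivity), ← ENNReal.ofReal_mul (by positivity),
        ← ENNReal.ofReal_mul (by positivity), ← ENNReal.ofReal_mul (by positivity),
        ← ENNReal.ofReal_add (by positivity) (by positivity),
        ← ENNReal.ofReal_mul (by positivity), ← ENNReal.ofReal_mul (by positivity)] at h3
    rw [ENNReal.ofReal_le_ofReal_iff (by positivity)] at h4
    rw [div_le_div_iff₀ two_pos (by positivity)]
    nlinarith
  refine (Finset.sum_le_sum fun k _ => hk k).trans_eq ?_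
  rw [Finset.sum_const, Finset.card_univ, Fintype.card_fin, nsmul_eq_mul]
  push_cast
  field_simp

end CellCovariance

/-! ### Conditional covariance given independent test points. -/

section CondIndep

variable {Ω β γ : Type*} {m₀ : MeasurableSpace Ω} [MeasurableSpace β] [MeasurableSpace γ]
  {P : Measure Ω} [IsProbabilityMeasure P] {μ : Measure β} [IsProbabilityMeasure μ]
  {ν : Measure γ} [IsProbabilityMeasure ν] {U : Ω → β} {D : Ω → γ}

/-- If `(U, D)` has a product law, conditioning on `U` integrates `D` out. -/
theorem condExp_comap_ae_eq_integral (hU : Measurable U) (hD : Measurable D)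
    (hUD : P.map (fun ω => (U ω, D ω)) = μ.prod ν) {h : β × γ → ℝ}
    (hh : Integrable h (μ.prod ν)) (hhm : StronglyMeasurable h) :
    P[fun ω => h (U ω, D ω) | MeasurableSpace.comap U inferInstance]
      =ᵐ[P] fun ω => ∫ z, h (U ω, z) ∂ν := by
  have hmp : MeasurePreserving (fun ω => (U ω, D ω)) P (μ.prod ν) := ⟨hU.prodMk hD, hUD⟩
  have hmU : MeasurePreserving U P μ := measurePreserving_fst.comp hmp
  have hg : StronglyMeasurable fun x => ∫ z, h (x, z) ∂ν := hhm.integral_prod_right'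
  have hgi : Integrable (fun ω => ∫ z, h (U ω, z) ∂ν) P :=
    (hmU.integrable_comp hg.aestronglyMeasurable).2 hh.integral_prod_left
  refine (ae_eq_condExp_of_forall_setIntegral_eq hU.comap_le
    ((hmp.integrable_comp hhm.aestronglyMeasurable).2 hh) (fun s _ _ => hgi.integrableOn)
    ?_ ?_).symm
  · rintro _ ⟨t, ht, rfl⟩ -
    have e1 : ∫ ω in U ⁻¹' t, h (U ω, D ω) ∂P = ∫ v in t ×ˢ Set.univ, h v ∂(μ.prod ν) := by
      rw [← hUD, setIntegral_map (ht.prod .univ) hhm.aestronglyMeasurable hmp.aemeasurable]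
      congr 2
      ext ω
      simp
    change _ = ∫ ω in U ⁻¹' t, h (U ω, D ω) ∂P
    rw [e1, setIntegral_prod _ hh.integrableOn, Measure.restrict_univ, ← hmU.map_eq,
      setIntegral_map ht hg.aestronglyMeasurable hU.aemeasurable]
  · exact (hg.comp_measurable (comap_measurable U)).aestronglyMeasurable

/-- The conditional covariance given `U`, for functions of `U` and of an independent `D`. -/
theorem condCovariance_ae_eq (hU : Measurable U) (hD : Measurable D)
    (hUD : P.map (fun ω => (U ω, D ω)) = μ.prod ν) {F G : β × γ → ℝ}
    (hF : MemLp F 2 (μ.prod ν)) (hG : MemLp G 2 (μ.prod ν))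
    (hFm : StronglyMeasurable F) (hGm : StronglyMeasurable G)
    (hF' : ∀ x, MemLp (fun z => F (x, z)) 2 ν) (hG' : ∀ x, MemLp (fun z => G (x, z)) 2 ν)
    {K : ℝ} (hFK : ∀ x, |∫ z, F (x, z) ∂ν| ≤ K) (hGK : ∀ x, |∫ z, G (x, z) ∂ν| ≤ K) :
    condCovariance (MeasurableSpace.comap U inferInstance) (fun ω => F (U ω, D ω))
        (fun ω => G (U ω, D ω)) P
      =ᵐ[P] fun ω => ∫ z, F (U ω, z) * G (U ω, z) ∂ν
        - (∫ z, F (U ω, z) ∂ν) * ∫ z, G (U ω, z) ∂ν := by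
  have hcF := condExp_comap_ae_eq_integral hU hD hUD (hF.integrable one_le_two) hFm
  have hcG := condExp_comap_ae_eq_integral hU hD hUD (hG.integrable one_le_two) hGm
  have sF : StronglyMeasurable fun v : β × γ => ∫ z, F (v.1, z) ∂ν :=
    hFm.integral_prod_right'.comp_measurable measurable_fst
  have sG : StronglyMeasurable fun v : β × γ => ∫ z, G (v.1, z) ∂ν :=
    hGm.integral_prod_right'.comp_measurable measurable_fst
  -- The uniform bound `K` makes the conditional means square integrable, so the product of centered
  -- variables is integrable.
  have mF : MemLp (fun v : β × γ => ∫ z, F (v.1, z) ∂ν) 2 (μ.prod ν) :=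
    MemLp.of_bound sF.aestronglyMeasurable K (.of_forall fun v => hFK v.1)
  have mG : MemLp (fun v : β × γ => ∫ z, G (v.1, z) ∂ν) 2 (μ.prod ν) :=
    MemLp.of_bound sG.aestronglyMeasurable K (.of_forall fun v => hGK v.1)
  have hprod := condExp_comap_ae_eq_integral (h := fun v => (F v - ∫ z, F (v.1, z) ∂ν) *
    (G v - ∫ z, G (v.1, z) ∂ν)) hU hD hUD ((hF.sub mF).integrable_mul (hG.sub mG))
    ((hFm.sub sF).mul (hGm.sub sG))
  rw [condCovariance]
  refine (condExp_congr_ae ?_).trans (hprod.trans (.of_forall fun ω => ?_))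
  · filter_upwards [hcF, hcG] with ω h1 h2
    simp only [Pi.mul_apply, Pi.sub_apply, h1, h2]
  · have := covariance_eq_sub (hF' (U ω)) (hG' (U ω))
    rw [covariance] at this
    exact this

theorem abs_covariance_average_le {ι : Type*} [Fintype ι] {T T' : ι → γ → ℝ}
    (hT : ∀ i, MemLp (T i) 2 ν) (hT' : ∀ i, MemLp (T' i) 2 ν) (c : ℝ) :
    |∫ z, ((∑ i, T i z) / c) * ((∑ i, T' i z) / c) ∂ν
        - (∫ z, (∑ i, T i z) / c ∂ν) * ∫ z, (∑ i, T' i z) / c ∂ν|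
      ≤ (∑ i, ∑ j, |∫ z, T i z * T' j z ∂ν - (∫ z, T i z ∂ν) * ∫ z, T' j z ∂ν|) / c ^ 2 := by
  have h1 : ∀ z, ((∑ i, T i z) / c) * ((∑ i, T' i z) / c)
      = (∑ i, ∑ j, T i z * T' j z) / c ^ 2 := by
    intro z
    rw [div_mul_div_comm, Finset.sum_mul_sum, sq]
  simp_rw [h1]
  have hi : ∀ i j, Integrable (fun z => T i z * T' j z) ν := fun i j =>
    (hT i).integrable_mul (hT' j)
  rw [integral_div, integral_div, integral_div, integral_finsetSum _ fun i _ =>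
      (integrable_finsetSum _ fun j _ => hi i j),
    integral_finsetSum _ fun i _ => (hT i).integrable one_le_two,
    integral_finsetSum _ fun i _ => (hT' i).integrable one_le_two,
    Finset.sum_congr rfl fun i _ => integral_finsetSum _ fun j _ => hi i j,
    div_mul_div_comm, ← sq, ← sub_div, Finset.sum_mul_sum, ← Finset.sum_sub_distrib, abs_div,
    abs_of_nonneg (sq_nonneg c)]
  gcongr
  refine (Finset.abs_sum_le_sum_abs _ _).trans (Finset.sum_le_sum fun i _ => ?_)
  rw [← Finset.sum_sub_distrib]
  exact Finset.abs_sum_le_sum_abs _ _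

end CondIndep

/-! ### The forest as an average of cell means, and the final estimate. -/

section Forest

variable {d : ℕ}

/-- The sums over trees and observations are interchanged; the guard against empty leaves is
absorbed by division by zero being zero. -/
theorem centeredForest_eq_average {n : ℕ} (κ : ℝ) (z : Fin n → (Fin d → ℝ) × ℝ)
    (x : Fin d → ℝ) :
    centeredForest κ (fun k => (z k).1) (fun k => (z k).2) x
      = (∑ θ : SplitTree d (splitDepth κ), cellMean (θ.leaf x) z)
        / Fintype.card (SplitTree d (splitDepth κ)) := by
  have h : ∀ (θ : SplitTree d (splitDepth κ)) k, treeWeight (fun k => (z k).1) θ x k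
      = (θ.leaf x).indicator 1 (z k).1 / cellCount (θ.leaf x) z := by
    intro θ k
    rw [treeWeight]
    change (if 0 < cellCount (θ.leaf x) z then
      (θ.leaf x).indicator 1 (z k).1 / cellCount (θ.leaf x) z else 0) = _
    split_ifs with h0
    · rfl
    · rw [le_antisymm (not_lt.1 h0) (cellCount_nonneg z), div_zero]
  simp only [centeredForest, forestWeight, h, div_mul_eq_mul_div, ← Finset.sum_div,
    Finset.sum_mul]
  rw [Finset.sum_comm]
  simp only [cellMean, Finset.sum_div]

theorem measurable_uncurry_cellMean_leaf {m : ℕ} (θ : SplitTree d m) (n : ℕ) :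
    Measurable fun v : (Fin d → ℝ) × (Fin n → (Fin d → ℝ) × ℝ) => cellMean (θ.leaf v.1) v.2 := by
  have h : ∀ k, Measurable fun v : (Fin d → ℝ) × (Fin n → (Fin d → ℝ) × ℝ) =>
      (θ.leaf v.1).indicator (1 : (Fin d → ℝ) → ℝ) (v.2 k).1 := by
    intro k
    have h1 : Measurable fun v : (Fin d → ℝ) × (Fin n → (Fin d → ℝ) × ℝ) => (v.1, (v.2 k).1) := by
      fun_prop
    exact (measurable_one.indicator θ.measurableSet_mem_leaf).comp h1
  refine (Finset.measurable_sum _ fun k _ => (h k).mul ?_).div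
    (Finset.measurable_sum _ fun k _ => h k)
  fun_prop

variable {Q : Measure ((Fin d → ℝ) × ℝ)} {M V : ℝ}

theorem IsForestLaw.measure_preimage_fst (hQ : IsForestLaw Q M V) {S : Set (Fin d → ℝ)}
    (hS : MeasurableSet S) : Q (Prod.fst ⁻¹' S) = uniformCube d S := by
  rw [← hQ.uniform, Measure.map_apply measurable_fst hS]

theorem IsForestLaw.isProbabilityMeasure (hQ : IsForestLaw Q M V) : IsProbabilityMeasure Q :=
  ⟨by simpa using hQ.measure_preimage_fst .univ⟩

/-- `E(Y² | X)` is the conditional variance plus the squared conditional mean. Using `|V|` keeps the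
constant nonnegative without a sign condition on `V`. -/
theorem IsForestLaw.lintegral_indicator_mul_sq_le (hQ : IsForestLaw Q M V)
    (S : Set (Fin d → ℝ)) (hS : MeasurableSet S) :
    ∫⁻ z, ENNReal.ofReal (S.indicator 1 z.1 * z.2 ^ 2) ∂Q
      ≤ ENNReal.ofReal (M ^ 2 + |V|) * Q (Prod.fst ⁻¹' S) := by
  have := hQ.isProbabilityMeasure
  have hm : covariateSigma d ≤ Prod.instMeasurableSpace := measurable_fst.comap_le
  have hsq : Integrable (Prod.snd ^ 2 : (Fin d → ℝ) × ℝ → ℝ) Q := hQ.memLp.integrable_sq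
  have hms : MeasurableSet[covariateSigma d] (Prod.fst ⁻¹' S : Set ((Fin d → ℝ) × ℝ)) :=
    ⟨S, hS, rfl⟩
  have hle : ∀ᵐ z ∂Q, (Q[(Prod.snd ^ 2 : (Fin d → ℝ) × ℝ → ℝ) | covariateSigma d]) z
      ≤ M ^ 2 + |V| := by
    filter_upwards [hQ.mean_le, hQ.var_le, condVar_ae_eq_condExp_sq_sub_sq_condExp hm hQ.memLp]
      with z h1 h2 h3
    simp only [Pi.sub_apply, Pi.pow_apply] at h3
    have h4 := sq_le_sq' (abs_le.1 h1).1 (abs_le.1 h1).2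
    linarith [le_abs_self V]
  have hind : ∀ z : (Fin d → ℝ) × ℝ, S.indicator 1 z.1 * z.2 ^ 2
      = (Prod.fst ⁻¹' S).indicator (Prod.snd ^ 2) z := by
    intro z
    by_cases h : z.1 ∈ S
    · rw [Set.indicator_of_mem h, Set.indicator_of_mem (show z ∈ Prod.fst ⁻¹' S from h)]; simp
    · rw [Set.indicator_of_notMem h, Set.indicator_of_notMem (show z ∉ Prod.fst ⁻¹' S from h)]
      simp
  simp_rw [hind]
  rw [← ofReal_integral_eq_lintegral_ofReal (hsq.indicator (measurable_fst hS))
    (.of_forall fun z => Set.indicator_nonneg (fun z _ => sq_nonneg _) z),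
    integral_indicator (measurable_fst hS), ← setIntegral_condExp hm hsq hms,
    ← ENNReal.ofReal_toReal (measure_ne_top Q (Prod.fst ⁻¹' S)),
    ← ENNReal.ofReal_mul (by positivity)]
  refine ENNReal.ofReal_le_ofReal ?_
  refine (setIntegral_mono_ae integrable_condExp.integrableOn
    (integrable_const (M ^ 2 + |V|)).integrableOn hle).trans_eq ?_
  rw [setIntegral_const, smul_eq_mul, mul_comm, measureReal_def]

/-- The mean overlap of the leaves of two independent uniform points. -/
theorem SplitTree.integral_leaf_inter_leaf {m : ℕ} (θ θ' : SplitTree d m) :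
    Integrable (fun v : (Fin d → ℝ) × (Fin d → ℝ) =>
        (uniformCube d).real (θ.leaf v.1 ∩ θ'.leaf v.2)) ((uniformCube d).prod (uniformCube d)) ∧
      ∫ v, (uniformCube d).real (θ.leaf v.1 ∩ θ'.leaf v.2)
        ∂((uniformCube d).prod (uniformCube d)) = ((2⁻¹ : ℝ) ^ m) ^ 2 := by
  have hmeas : Measurable fun v : (Fin d → ℝ) × (Fin d → ℝ) =>
      uniformCube d (θ.leaf v.1 ∩ θ'.leaf v.2) := by
    have h1 : Measurable fun v : ((Fin d → ℝ) × (Fin d → ℝ)) × (Fin d → ℝ) => (v.1.1, v.2) := by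
      fun_prop
    have h2 : Measurable fun v : ((Fin d → ℝ) × (Fin d → ℝ)) × (Fin d → ℝ) => (v.1.2, v.2) := by
      fun_prop
    exact measurable_measure_prodMk_left
      ((h1 θ.measurableSet_mem_leaf).inter (h2 θ'.measurableSet_mem_leaf))
  constructor
  · exact Integrable.of_bound hmeas.ennreal_toReal.aestronglyMeasurable 1 (.of_forall fun v => by
      rw [Real.norm_of_nonneg measureReal_nonneg]; exact measureReal_le_one)
  · simp only [measureReal_def]
    rw [integral_toReal hmeas.aemeasurable (.of_forall fun v => measure_lt_top _ _),
      lintegral_prod _ hmeas.aemeasurable]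
    simp_rw [θ'.lintegral_uniformCube_leaf_inter (θ.measurableSet_leaf _), θ.uniformCube_leaf]
    simp [sq]

/-- The covariance of the predictions at two points, in terms of the overlaps of the leaves. -/
theorem IsForestLaw.abs_covariance_centeredForest_le (hQ : IsForestLaw Q M V) {n : ℕ} (hn : 0 < n)
    (κ : ℝ) (x x' : Fin d → ℝ) :
    |∫ z, centeredForest κ (fun k => (z k).1) (fun k => (z k).2) x
          * centeredForest κ (fun k => (z k).1) (fun k => (z k).2) x'
          ∂(Measure.pi fun _ : Fin n => Q)
        - (∫ z, centeredForest κ (fun k => (z k).1) (fun k => (z k).2) x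
          ∂(Measure.pi fun _ : Fin n => Q))
        * ∫ z, centeredForest κ (fun k => (z k).1) (fun k => (z k).2) x'
          ∂(Measure.pi fun _ : Fin n => Q)|
      ≤ (∑ θ : SplitTree d (splitDepth κ), ∑ θ' : SplitTree d (splitDepth κ),
          8 * (M ^ 2 + |V|) * ((uniformCube d).real (θ.leaf x ∩ θ'.leaf x')
            + ((2⁻¹ : ℝ) ^ splitDepth κ) ^ 2) / (n * ((2⁻¹ : ℝ) ^ splitDepth κ) ^ 2))
        / (Fintype.card (SplitTree d (splitDepth κ)) : ℝ) ^ 2 := by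
  have := hQ.isProbabilityMeasure
  simp_rw [centeredForest_eq_average]
  refine (abs_covariance_average_le
    (fun θ : SplitTree d (splitDepth κ) => memLp_cellMean hQ.memLp (θ.measurableSet_leaf x) n)
    (fun θ : SplitTree d (splitDepth κ) => memLp_cellMean hQ.memLp (θ.measurableSet_leaf x') n)
    _).trans ?_
  gcongr with θ _ θ' _
  have hp : ∀ (θ : SplitTree d (splitDepth κ)) (x : Fin d → ℝ),
      Q (Prod.fst ⁻¹' θ.leaf x) = ENNReal.ofReal (2⁻¹ ^ splitDepth κ) := by
    intro θ x
    rw [hQ.measure_preimage_fst (θ.measurableSet_leaf x), θ.uniformCube_leaf,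
      ENNReal.ofReal_pow (by norm_num), ENNReal.ofReal_inv_of_pos two_pos, ENNReal.ofReal_ofNat]
  have h := abs_covariance_cellMean_le (θ.measurableSet_leaf x) (θ'.measurableSet_leaf x')
    (by positivity) hQ.lintegral_indicator_mul_sq_le hQ.memLp (p := 2⁻¹ ^ splitDepth κ)
    (by positivity) (hp θ x) (hp θ' x') hn
  rwa [measureReal_def, hQ.measure_preimage_fst
    ((θ.measurableSet_leaf x).inter (θ'.measurableSet_leaf x')), ← measureReal_def] at h

theorem abs_centeredForest_le {n : ℕ} (κ : ℝ) (z : Fin n → (Fin d → ℝ) × ℝ) (x : Fin d → ℝ) :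
    |centeredForest κ (fun k => (z k).1) (fun k => (z k).2) x| ≤ ∑ k, |(z k).2| := by
  rw [centeredForest_eq_average, abs_div, Nat.abs_cast]
  refine div_le_of_le_mul₀ (Nat.cast_nonneg _) (Finset.sum_nonneg fun _ _ => abs_nonneg _) ?_
  refine (Finset.abs_sum_le_sum_abs _ _).trans ((Finset.sum_le_sum fun θ _ =>
    abs_cellMean_le z).trans_eq ?_)
  rw [Finset.sum_const, Finset.card_univ, nsmul_eq_mul, mul_comm]

/-- The mean absolute conditional covariance of the predictions at two random test points. -/
theorem integral_abs_condCovariance_centeredForest_le {n : ℕ} (hn : 0 < n) (κ : ℝ) {Ω : Type*}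
    [MeasurableSpace Ω] {P : Measure Ω} [IsProbabilityMeasure P] {X : Fin n → Ω → Fin d → ℝ}
    {Y : Fin n → Ω → ℝ} {ξ ξ' : Ω → Fin d → ℝ} (hQ : IsForestLaw Q M V)
    (hS : IsForestSample P Q X Y ξ ξ') :
    ∫ ω, |condCovariance (MeasurableSpace.comap (fun ω => (ξ ω, ξ' ω)) inferInstance)
        (fun ω => centeredForest κ (fun k => X k ω) (fun k => Y k ω) (ξ ω))
        (fun ω => centeredForest κ (fun k => X k ω) (fun k => Y k ω) (ξ' ω)) P ω| ∂P
      ≤ 16 * (M ^ 2 + |V|) / n := by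
  have := hQ.isProbabilityMeasure
  set τ := (uniformCube d).prod (uniformCube d) with hτ
  set ν := Measure.pi fun _ : Fin n => Q with hν
  have : IsProbabilityMeasure ν := by rw [hν]; infer_instance
  have : SigmaFinite ν := inferInstance
  have : SFinite ν := inferInstance
  have : IsProbabilityMeasure τ := by rw [hτ]; infer_instance
  let U : Ω → (Fin d → ℝ) × (Fin d → ℝ) := fun ω => (ξ ω, ξ' ω)
  let D : Ω → Fin n → (Fin d → ℝ) × ℝ := fun ω k => (X k ω, Y k ω)
  have hU : Measurable U := hS.measurable_test.prodMk hS.measurable_test'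
  have hDk : ∀ k, Measurable fun ω => (X k ω, Y k ω) := fun k =>
    (hS.measurable_X k).prodMk (hS.measurable_Y k)
  have hD : Measurable D := measurable_pi_iff.2 hDk
  have hUlaw : P.map U = τ := by
    rw [(indepFun_iff_map_prod_eq_prod_map_map hS.measurable_test.aemeasurable
      hS.measurable_test'.aemeasurable).1 hS.indep_test, hS.law_test, hS.law_test', hQ.uniform]
  have hDlaw : P.map D = ν := by
    rw [(iIndepFun_iff_map_fun_eq_pi_map fun k => (hDk k).aemeasurable).1 hS.indep_train]
    simp_rw [hS.law_train]
    rfl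
  have hUD : P.map (fun ω => (U ω, D ω)) = τ.prod ν := by
    rw [(indepFun_iff_map_prod_eq_prod_map_map hU.aemeasurable hD.aemeasurable).1
      hS.indep_test_train, hUlaw, hDlaw]
  let f : (Fin d → ℝ) × (Fin n → (Fin d → ℝ) × ℝ) → ℝ := fun v =>
    centeredForest κ (fun k => (v.2 k).1) (fun k => (v.2 k).2) v.1
  have hf : Measurable f := by
    simp only [f, centeredForest_eq_average]
    exact (Finset.measurable_sum _ fun θ _ => measurable_uncurry_cellMean_leaf θ n).div_const _
  have hsum : MemLp (fun z : Fin n → (Fin d → ℝ) × ℝ => ∑ k, |(z k).2|) 2 ν :=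
    memLp_finsetSum _ fun k _ =>
      (hQ.memLp.comp_measurePreserving (measurePreserving_eval (fun _ : Fin n => Q) k)).abs
  have hfx : ∀ x, MemLp (fun z => f (x, z)) 2 ν := fun x =>
    hsum.mono (hf.comp measurable_prodMk_left).aestronglyMeasurable (.of_forall fun z => by
      rw [Real.norm_eq_abs, Real.norm_of_nonneg (Finset.sum_nonneg fun _ _ => abs_nonneg _)]
      exact abs_centeredForest_le κ z x)
  have hfK : ∀ x, |∫ z, f (x, z) ∂ν| ≤ ∫ z, ∑ k, |(z k).2| ∂ν := fun x =>
    (abs_integral_le_integral_abs).trans (integral_mono ((hfx x).integrable one_le_two).abs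
      (hsum.integrable one_le_two) fun z => abs_centeredForest_le κ z x)
  let F : ((Fin d → ℝ) × (Fin d → ℝ)) × (Fin n → (Fin d → ℝ) × ℝ) → ℝ := fun v => f (v.1.1, v.2)
  let G : ((Fin d → ℝ) × (Fin d → ℝ)) × (Fin n → (Fin d → ℝ) × ℝ) → ℝ := fun v => f (v.1.2, v.2)
  have hFm : Measurable F := hf.comp (by fun_prop)
  have hGm : Measurable G := hf.comp (by fun_prop)
  have hsum' : MemLp (fun v : ((Fin d → ℝ) × (Fin d → ℝ)) × (Fin n → (Fin d → ℝ) × ℝ) =>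
      ∑ k, |(v.2 k).2|) 2 (τ.prod ν) := hsum.comp_measurePreserving measurePreserving_snd
  have hF : MemLp F 2 (τ.prod ν) :=
    hsum'.mono hFm.aestronglyMeasurable (.of_forall fun v => by
      rw [Real.norm_eq_abs, Real.norm_of_nonneg (Finset.sum_nonneg fun _ _ => abs_nonneg _)]
      exact abs_centeredForest_le κ v.2 v.1.1)
  have hG : MemLp G 2 (τ.prod ν) :=
    hsum'.mono hGm.aestronglyMeasurable (.of_forall fun v => by
      rw [Real.norm_eq_abs, Real.norm_of_nonneg (Finset.sum_nonneg fun _ _ => abs_nonneg _)]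
      exact abs_centeredForest_le κ v.2 v.1.2)
  -- The conditional covariance becomes an ordinary covariance over the training sample at fixed
  -- test points.
  have hcov := condCovariance_ae_eq hU hD hUD hF hG hFm.stronglyMeasurable hGm.stronglyMeasurable
    (fun x => hfx x.1) (fun x => hfx x.2) (fun x => hfK x.1) (fun x => hfK x.2)
  let c : (Fin d → ℝ) × (Fin d → ℝ) → ℝ := fun x =>
    ∫ z, F (x, z) * G (x, z) ∂ν - (∫ z, F (x, z) ∂ν) * ∫ z, G (x, z) ∂ν
  have hc : StronglyMeasurable c :=
    ((hFm.mul hGm).stronglyMeasurable.integral_prod_right').sub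
      (hFm.stronglyMeasurable.integral_prod_right'.mul hGm.stronglyMeasurable.integral_prod_right')
  have hmU : MeasurePreserving U P τ := ⟨hU, hUlaw⟩
  have e1 : ∫ ω, |condCovariance (MeasurableSpace.comap U inferInstance)
      (fun ω => F (U ω, D ω)) (fun ω => G (U ω, D ω)) P ω| ∂P = ∫ x, |c x| ∂τ := by
    rw [← hUlaw, integral_map hU.aemeasurable
      (continuous_abs.comp_stronglyMeasurable hc).aestronglyMeasurable]
    exact integral_congr_ae (hcov.mono fun ω h => congrArg abs h)
  change ∫ ω, |condCovariance (MeasurableSpace.comap U inferInstance)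
      (fun ω => F (U ω, D ω)) (fun ω => G (U ω, D ω)) P ω| ∂P ≤ _
  rw [e1]
  set N : ℝ := (Fintype.card (SplitTree d (splitDepth κ)) : ℝ) with hN
  set p : ℝ := (2⁻¹ : ℝ) ^ splitDepth κ with hp
  have hp0 : 0 < p := by positivity
  have hn0 : (0 : ℝ) < n := Nat.cast_pos.2 hn
  have hint : ∀ θ θ' : SplitTree d (splitDepth κ), Integrable (fun v =>
      8 * (M ^ 2 + |V|) * ((uniformCube d).real (θ.leaf v.1 ∩ θ'.leaf v.2) + p ^ 2)
        / (n * p ^ 2)) τ := fun θ θ' =>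
    ((((θ.integral_leaf_inter_leaf θ').1.add (integrable_const _)).const_mul _).div_const _)
  -- The mean overlap is `p ^ 2`, so the bracket integrates to `2 p ^ 2` and the leaf size cancels:
  -- no dependence on the depth or on the trees remains.
  have hval : ∀ θ θ' : SplitTree d (splitDepth κ), ∫ v,
      8 * (M ^ 2 + |V|) * ((uniformCube d).real (θ.leaf v.1 ∩ θ'.leaf v.2) + p ^ 2)
        / (n * p ^ 2) ∂τ = 16 * (M ^ 2 + |V|) / n := by
    intro θ θ'
    rw [integral_div, integral_const_mul, integral_add (θ.integral_leaf_inter_leaf θ').1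
      (integrable_const _), (θ.integral_leaf_inter_leaf θ').2, integral_const, probReal_univ,
      one_smul, ← hp]
    field_simp
    ring
  calc ∫ x, |c x| ∂τ
      ≤ ∫ v, (∑ θ : SplitTree d (splitDepth κ), ∑ θ' : SplitTree d (splitDepth κ),
          8 * (M ^ 2 + |V|) * ((uniformCube d).real (θ.leaf v.1 ∩ θ'.leaf v.2) + p ^ 2)
            / (n * p ^ 2)) / N ^ 2 ∂τ := by
        refine integral_mono_of_nonneg (.of_forall fun x => abs_nonneg _)
          ((integrable_finsetSum _ fun θ _ => integrable_finsetSum _ fun θ' _ =>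
            hint θ θ').div_const _) (.of_forall fun x => ?_)
        exact hQ.abs_covariance_centeredForest_le hn κ x.1 x.2
    _ = N ^ 2 / N ^ 2 * (16 * (M ^ 2 + |V|) / n) := by
        rw [integral_div, integral_finsetSum _ fun θ _ => integrable_finsetSum _ fun θ' _ =>
          hint θ θ']
        simp_rw [integral_finsetSum _ fun θ' _ => hint _ θ', hval]
        rw [Finset.sum_const, Finset.sum_const, Finset.card_univ, nsmul_eq_mul, nsmul_eq_mul,
          ← hN]
        ring
    -- Only `N ^ 2 / N ^ 2 ≤ 1` is used, so the set of trees need not be known to be nonempty.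
    _ ≤ 16 * (M ^ 2 + |V|) / n :=
        mul_le_of_le_one_left (by positivity) (div_self_le_one _)

end Forest

theorem mainTheorem7 (d : ℕ) (hd : 1 ≤ d) (M V : ℝ) :
    ∃ C : ℝ, ∀ κ : ℕ → ℝ, Tendsto κ atTop atTop →
      ∀ᶠ n : ℕ in atTop,
        ∀ (Ω : Type*) [MeasurableSpace Ω] (P : Measure Ω) [IsProbabilityMeasure P]
          (Q : Measure ((Fin d → ℝ) × ℝ)) (X : Fin n → Ω → Fin d → ℝ) (Y : Fin n → Ω → ℝ)
          (ξ ξ' : Ω → Fin d → ℝ),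
          IsForestLaw Q M V → IsForestSample P Q X Y ξ ξ' →
            ∫ ω, |condCovariance
                (MeasurableSpace.comap (fun ω => (ξ ω, ξ' ω)) inferInstance)
                (fun ω => centeredForest (κ n) (fun k => X k ω) (fun k => Y k ω) (ξ ω))
                (fun ω => centeredForest (κ n) (fun k => X k ω) (fun k => Y k ω) (ξ' ω))
                P ω| ∂P
              ≤ C * Real.log (κ n) ^ (d - 1) / n := by
  refine ⟨16 * (M ^ 2 + |V|), fun κ hκ => ?_⟩
  -- Once `log (κ n) ≥ 1`, its power is at least one and can be inserted for free.
  filter_upwards [(Real.tendsto_log_atTop.comp hκ).eventually_ge_atTop 1, eventually_gt_atTop 0]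
    with n hlog hn Ω _ P _ Q X Y ξ ξ' hQ hS
  refine (integral_abs_condCovariance_centeredForest_le hn (κ n) hQ hS).trans ?_
  refine div_le_div_of_nonneg_right ?_ n.cast_nonneg
  exact le_mul_of_one_le_right (by positivity) (one_le_pow₀ hlog)
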